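/- Let $A\in\mathbb{R}^{n\times n}$, $C\in\mathbb{R}^{m\times n}$, and consider $x_{k+1}=Ax_k+w_k$, $y_k=Cx_k+v_k$ for $k\ge 0$, where $x_0\sim\mathcal N(0,\Pi_0)$, $w_k\sim\mathcal N(0,Q)$, $v_k\sim\mathcal N(0,R)$ ($k\ge0$) are mutually independent, with $\Pi_0\succeq0$, $Q\succeq 0$, $R\succ0$. The sensor's local estimate is $\hat x_k^s=\mathbb{E}[x_k\mid y_1,\dots,y_k]$ (so $\hat x_0^s=0$ a.s.). At each time $k\ge1$ the sensor sends $\hat x_k^s$ over an unreliable channel; $\gamma_k=1$ if it is received, $\gamma_k=0$ if it is dropped, and $\gamma_0=1$. Let $\tau=\tau(k)=k-\max\{0\le t\le k-1:\gamma_t=1\}$ be the holding time and $\varepsilon_k=\hat x_k^s-A^{\tau}\hat x_{k-\tau}^s$ the incremental innovation. Under the controller $\theta_{\mathrm{ef}}$ the sensor uses the transmission power $$\omega_k=\frac{N_0W}{2\alpha}\,\varepsilon_k'\mathcal{Q}_{\tau}\varepsilon_k+\omega ,$$ where $N_0,W>0$, $\alpha\in(0,1]$, $\omega\ge0$ are constants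 and $(\mathcal Q_t)_t$ are fixed symmetric positive semidefinite weight matrices. The channel is memoryless with noise independent of the system: for $k\ge1$, given $x_0$, all $w_j,v_j$, and $\gamma_1,\dots,\gamma_{k-1}$, the packet is dropped with probability $q^{\omega_k}$, where $q=\exp(-\alpha/(N_0W))$. Let $\mathrm I_k$ be the information generated by $\gamma_1\hat x^s_1,\dots,\gamma_k\hat x^s_k$ and $\gamma_1,\dots,\gamma_k$ ($\mathrm I_0$ is trivial), and let $\hat x_k=\mathbb{E}[x_k\mid \mathrm I_k]$ be the remote MMSE estimate. Then for every $k\ge1$ the vectors $x_k$ and $\varepsilon_k$ are integrable and, almost surely, $$\hat x_k=\begin{cases}\hat x_k^s,&\text{if }\gamma_k=1,\\ A^{\tau}\hat x_{k-\tau}^s,&\text{if }\gamma_k=0,\end{cases}$$ where $\hat x_k^s=A^{\tau}\hat x_{k-\tau}^s+\varepsilon_k$ when $\gamma_k=1$. Moreover $\mathbb{E}[\varepsilon_k\mid \mathrm I_{k-1},\gamma_k=0]=0$ almost surely on $\{\gamma_k=0\}$. -/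

import Mathlib

open MeasureTheory ProbabilityTheory

/-- Euclidean space of dimension `d`. -/
abbrev Vec (d : ℕ) : Type := EuclideanSpace ℝ (Fin d)

/-- The data of the remote estimation problem: the matrices of the linear system
`x (k+1) = A x k + w k`, `y k = C x k + v k`, the covariances of its initial state and noises, the
channel constants, the parameters of the data-driven power controller, and the underlying random
variables on the sample space `Ω`. The laws of these objects are stated in
`RemoteEstimation.IsModel`. -/
structure RemoteEstimation (n m : ℕ) (Ω : Type*) where
  /-- state matrix -/
  A : Matrix (Fin n) (Fin n) ℝ
  /-- measurement matrix -/
  C : Matrix (Fin m) (Fin n) ℝ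
  /-- covariance of the process noise -/
  Q : Matrix (Fin n) (Fin n) ℝ
  /-- covariance of the measurement noise -/
  R : Matrix (Fin m) (Fin m) ℝ
  /-- covariance of the initial state -/
  initCov : Matrix (Fin n) (Fin n) ℝ
  /-- noise power spectral density of the channel -/
  N₀ : ℝ
  /-- bandwidth of the channel -/
  W : ℝ
  /-- modulation constant -/
  α : ℝ
  /-- weight matrices of the controller, indexed by the holding time -/
  weight : ℕ → Matrix (Fin n) (Fin n) ℝ
  /-- constant term of the controller -/
  basePower : ℝ
  /-- initial state -/
  x₀ : Ω → Vec n
  /-- process noise -/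
  w : ℕ → Ω → Vec n
  /-- measurement noise -/
  v : ℕ → Ω → Vec m
  /-- packet arrivals: `γ k = 1` if the packet of time `k` is received, `γ k = 0` if it is lost -/
  γ : ℕ → Ω → ℝ

namespace RemoteEstimation

noncomputable section

variable {n m : ℕ} {Ω : Type*} (M : RemoteEstimation n m Ω)

/-- The state process: `x 0 = x₀`, `x (k+1) = A x k + w k`. -/
def x : ℕ → Ω → Vec n
  | 0 => M.x₀
  | k + 1 => fun s => M.A.toEuclideanLin (x k s) + M.w k s

/-- The measurement process `y k = C x k + v k`. -/
def y (k : ℕ) (s : Ω) : Vec m := M.C.toEuclideanLin (M.x k s) + M.v k s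

/-- The σ-algebra generated by the measurements `y 1, …, y k`. -/
@[reducible] def sensorInfo (k : ℕ) : MeasurableSpace Ω :=
  ⨆ j ∈ Finset.Icc 1 k, MeasurableSpace.comap (M.y j) inferInstance

/-- The holding time `τ(k) = k - max {t < k : γ t = 1}`. -/
def holdingTime (k : ℕ) (s : Ω) : ℕ := k - sSup {t : ℕ | t < k ∧ M.γ t s = 1}

/-- The base of the dropout probability, `q = exp (-α / (N₀ W))`. -/
def q : ℝ := Real.exp (-M.α / (M.N₀ * M.W))

variable [MeasurableSpace Ω] (μ : Measure Ω)

/-- The local estimate of the sensor, `𝔼[x k | y 1, …, y k]`. -/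
def localEst (k : ℕ) : Ω → Vec n := μ[M.x k | M.sensorInfo k]

/-- The prediction `A ^ τ x̂ˢ (k - τ)` from the last local estimate that was received before time
`k`, where `τ = τ(k)`. -/
def prediction (k : ℕ) (s : Ω) : Vec n :=
  (M.A ^ M.holdingTime k s).toEuclideanLin (M.localEst μ (k - M.holdingTime k s) s)

/-- The incremental innovation `ε k = x̂ˢ k - A ^ τ x̂ˢ (k - τ)`. -/
def innovation (k : ℕ) (s : Ω) : Vec n := M.localEst μ k s - M.prediction μ k s

/-- The transmission power chosen by the data-driven controller:
`N₀ W / (2 α) * (ε k)ᵀ 𝒬_τ (ε k) + basePower`. -/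
def power (k : ℕ) (s : Ω) : ℝ :=
  M.N₀ * M.W / (2 * M.α) *
      inner ℝ (M.innovation μ k s)
        ((M.weight (M.holdingTime k s)).toEuclideanLin (M.innovation μ k s)) + M.basePower

/-- The information of the remote estimator at time `k`: the σ-algebra generated by
`γ 1, …, γ k` and `γ 1 • x̂ˢ 1, …, γ k • x̂ˢ k`. -/
@[reducible] def remoteInfo (k : ℕ) : MeasurableSpace Ω :=
  ⨆ j ∈ Finset.Icc 1 k, (MeasurableSpace.comap (M.γ j) inferInstance ⊔
    MeasurableSpace.comap (fun s => M.γ j s • M.localEst μ j s) inferInstance)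

/-- The remote minimum mean square error estimate, the conditional mean of `x k` given the
information of the remote estimator at time `k`. -/
def remoteEst (k : ℕ) : Ω → Vec n := μ[M.x k | M.remoteInfo μ k]

/-- The σ-algebra generated by the initial state, all the noises `w j` and `v j`, and the packet
arrivals `γ 1, …, γ (k - 1)` before time `k`. -/
@[reducible] def channelPast (k : ℕ) : MeasurableSpace Ω :=
  MeasurableSpace.comap M.x₀ inferInstance ⊔
  (⨆ j, MeasurableSpace.comap (M.w j) inferInstance) ⊔
  (⨆ j, MeasurableSpace.comap (M.v j) inferInstance) ⊔
  ⨆ j ∈ Finset.Ico 1 k, MeasurableSpace.comap (M.γ j) inferInstance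

/-- The laws of the model under the data-driven power controller. The initial state and the noises
are mutually independent centred Gaussian vectors. The channel is memoryless and its noise is
independent of the system: given the system noises and the earlier packet arrivals, the packet of
time `k` is lost with probability `q ^ ω`, where `ω` is the power used at time `k`. -/
structure IsModel : Prop where
  posSemidef_Q : M.Q.PosSemidef
  posDef_R : M.R.PosDef
  posSemidef_initCov : M.initCov.PosSemidef
  N₀_pos : 0 < M.N₀
  W_pos : 0 < M.W
  α_pos : 0 < M.α
  α_le_one : M.α ≤ 1
  posSemidef_weight : ∀ t, (M.weight t).PosSemidef
  basePower_nonneg : 0 ≤ M.basePower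
  measurable_x₀ : Measurable M.x₀
  measurable_w : ∀ k, Measurable (M.w k)
  measurable_v : ∀ k, Measurable (M.v k)
  measurable_γ : ∀ k, Measurable (M.γ k)
  hasLaw_x₀ : HasLaw M.x₀ (multivariateGaussian 0 M.initCov) μ
  hasLaw_w : ∀ k, HasLaw (M.w k) (multivariateGaussian 0 M.Q) μ
  hasLaw_v : ∀ k, HasLaw (M.v k) (multivariateGaussian 0 M.R) μ
  indep : iIndep (Sum.elim (fun _ : Unit => MeasurableSpace.comap M.x₀ inferInstance)
    (Sum.elim (fun j : ℕ => MeasurableSpace.comap (M.w j) inferInstance)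
      (fun j : ℕ => MeasurableSpace.comap (M.v j) inferInstance))) μ
  γ_mem : ∀ k s, M.γ k s = 0 ∨ M.γ k s = 1
  γ_zero : ∀ s, M.γ 0 s = 1
  drop_prob : ∀ k, 1 ≤ k →
    μ[(M.γ k ⁻¹' {0}).indicator (fun _ => (1 : ℝ)) | M.channelPast k]
      =ᵐ[μ] fun s => M.q ^ M.power μ k s

end

end RemoteEstimation

/-! A lost packet carries information, because the dropout probability depends on the innovation.
The remote estimate has the naive form only because this probability is an even function of the
innovation, while the innovation has a symmetric law. All local estimates are, up to null sets,
linear statistics of the centred Gaussian noises (`condExp_mem_aeSpan`), so every family of them is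
jointly Gaussian. For fixed `j`, the increments `x̂ˢ i - A ^ (i - j) x̂ˢ j` with `i ≥ j` have zero
conditional mean given `y 1, …, y j`. They are therefore jointly independent of these measurements,
and jointly symmetric under a common sign change (`integral_odd_increment_mul`). Partition the
sample space by the pattern `G` of arrivals. Given the noises, a pattern has as probability a
product of factors that are even in the increments from the last arrival before each time
(`setIntegral_patternEvent`). On a pattern whose last arrival before `k` is `j` and whose packet `k`
is lost, the remote information reduces to measurements up to `j`. The innovation times all factors
after `j` is an odd function of the increments from `j`; everything else is a function of `y 1, …, y
j`. So its integral vanishes (`integral_increment_mul_prod_transProb`). Summing over patterns, the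
innovation integrates to zero over every remote event intersected with `{γ k = 0}`. The same change
to products of factors gives that the state and its local estimate have equal integrals over remote
events. Together these identify the conditional mean. -/

section GaussianSpace

/-! ### Linear statistics of a centred Gaussian process -/

variable {Ω T : Type*} {mΩ : MeasurableSpace Ω}

/-- The real functions that agree almost everywhere with a linear combination of the family `X`. -/
def aeSpan (μ : Measure Ω) (X : T → Ω → ℝ) : Submodule ℝ (Ω → ℝ) where
  carrier := {f | ∃ g ∈ Submodule.span ℝ (Set.range X), f =ᵐ[μ] g}
  add_mem' := by
    rintro f f' ⟨g, hg, hfg⟩ ⟨g', hg', hfg'⟩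
    exact ⟨g + g', add_mem hg hg', hfg.add hfg'⟩
  zero_mem' := ⟨0, zero_mem _, .rfl⟩
  smul_mem' := by
    rintro c f ⟨g, hg, hfg⟩
    exact ⟨c • g, Submodule.smul_mem _ c hg, hfg.const_smul c⟩

variable {μ : Measure Ω} {X : T → Ω → ℝ}

theorem mem_aeSpan_of_ae_eq {f g : Ω → ℝ} (h : f =ᵐ[μ] g) (hg : g ∈ aeSpan μ X) :
    f ∈ aeSpan μ X := by
  obtain ⟨g', hg', hgg'⟩ := hg
  exact ⟨g', hg', h.trans hgg'⟩

theorem self_mem_aeSpan (t : T) : X t ∈ aeSpan μ X :=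
  ⟨X t, Submodule.subset_span ⟨t, rfl⟩, .rfl⟩

theorem ProbabilityTheory.IsGaussianProcess.aeSpan (hX : IsGaussianProcess X μ) :
    IsGaussianProcess (fun (f : aeSpan μ X) => (f : Ω → ℝ)) μ := by
  choose g hg hfg using fun f : _root_.aeSpan μ X => f.2
  refine IsGaussianProcess.congr (X := g) ?_ fun f => (hfg f).symm
  refine hX.of_isGaussianProcess fun f => ?_
  obtain ⟨c, hc⟩ := Finsupp.mem_span_range_iff_exists_finsupp.1 (hg f)
  refine ⟨c.support, ∑ i : c.support, c i • ContinuousLinearMap.proj i, fun ω => ?_⟩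
  rw [← hc, Finsupp.sum]
  simp only [Finset.sum_apply, Pi.smul_apply, FunLike.coe_sum,
    FunLike.coe_smul, ContinuousLinearMap.proj_apply, Finset.restrict]
  exact (Finset.sum_coe_sort c.support fun i => c i • X i ω).symm

theorem ProbabilityTheory.IsGaussianProcess.of_mem_aeSpan (hX : IsGaussianProcess X μ) {S : Type*}
    {Z : S → Ω → ℝ} (hZ : ∀ s, Z s ∈ _root_.aeSpan μ X) : IsGaussianProcess Z μ :=
  hX.aeSpan.comp_right fun s => (⟨Z s, hZ s⟩ : _root_.aeSpan μ X)

theorem ProbabilityTheory.IsGaussianProcess.memLp_two_of_mem_aeSpan (hX : IsGaussianProcess X μ)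
    {f : Ω → ℝ} (hf : f ∈ _root_.aeSpan μ X) : MemLp f 2 μ :=
  (hX.aeSpan.hasGaussianLaw_eval ⟨f, hf⟩).memLp_two

theorem ProbabilityTheory.IsGaussianProcess.integral_eq_zero_of_mem_aeSpan
    (hX : IsGaussianProcess X μ) (h0 : ∀ t, ∫ ω, X t ω ∂μ = 0) {f : Ω → ℝ}
    (hf : f ∈ _root_.aeSpan μ X) : ∫ ω, f ω ∂μ = 0 := by
  obtain ⟨g, hg, hfg⟩ := hf
  rw [integral_congr_ae hfg]
  clear hfg
  suffices Integrable g μ ∧ ∫ ω, g ω ∂μ = 0 from this.2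
  induction hg using Submodule.span_induction with
  | mem x hx =>
    obtain ⟨t, rfl⟩ := hx
    exact ⟨(hX.hasGaussianLaw_eval t).integrable, h0 t⟩
  | zero => exact ⟨integrable_zero _ _ _, by simp⟩
  | add x y _ _ hx hy =>
    refine ⟨hx.1.add hy.1, ?_⟩
    simp only [Pi.add_apply]
    rw [integral_add hx.1 hy.1, hx.2, hy.2, add_zero]
  | smul c x _ hx =>
    refine ⟨hx.1.smul c, ?_⟩
    simp only [Pi.smul_apply]
    rw [integral_smul, hx.2, smul_zero]

/-- Jointly Gaussian families are independent once uncorrelated, and for centred variables the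
covariance is the integral of the product. -/
theorem ProbabilityTheory.IsGaussianProcess.indepFun_of_mem_aeSpan (hX : IsGaussianProcess X μ)
    (h0 : ∀ t, ∫ ω, X t ω ∂μ = 0) {S S' : Type*} {Z : S → Ω → ℝ} {Y : S' → Ω → ℝ}
    (hZ : ∀ s, Z s ∈ _root_.aeSpan μ X) (hY : ∀ s, Y s ∈ _root_.aeSpan μ X)
    (h : ∀ s s', ∫ ω, Z s ω * Y s' ω ∂μ = 0) :
    IndepFun (fun ω s => Z s ω) (fun ω s => Y s ω) μ := by
  have := hX.isProbabilityMeasure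
  have hG : IsGaussianProcess (Sum.elim Z Y) μ := hX.of_mem_aeSpan fun s => by
    cases s
    exacts [hZ _, hY _]
  refine hG.indepFun_of_covariance_eq_zero (fun s => hG.aemeasurable (.inl s))
    (fun s => hG.aemeasurable (.inr s)) fun s t => ?_
  rw [covariance_eq_sub (hX.memLp_two_of_mem_aeSpan (hZ s)) (hX.memLp_two_of_mem_aeSpan (hY t)),
    hX.integral_eq_zero_of_mem_aeSpan h0 (hZ s)]
  simpa using h s t

/-- The normal equations: `c` holds coefficients of the orthogonal projection of `f` in `L²` onto
the span of the `Y i`. -/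
theorem exists_integral_sub_sum_mul_eq_zero {ι : Type*} [Fintype ι] {f : Ω → ℝ} {Y : ι → Ω → ℝ}
    (hf : MemLp f 2 μ) (hY : ∀ i, MemLp (Y i) 2 μ) :
    ∃ c : ι → ℝ, ∀ i, ∫ ω, (f ω - ∑ j, c j * Y j ω) * Y i ω ∂μ = 0 := by
  let V : Submodule ℝ (Lp ℝ 2 μ) := Submodule.span ℝ (Set.range fun i => (hY i).toLp)
  have : FiniteDimensional ℝ V := FiniteDimensional.span_of_finite ℝ (Set.finite_range _)
  obtain ⟨c, hc⟩ := (Submodule.mem_span_range_iff_exists_fun ℝ).1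
    (V.starProjection_apply_mem hf.toLp)
  refine ⟨c, fun i => ?_⟩
  have h := V.sub_starProjection_mem_orthogonal hf.toLp
  have h' := (Submodule.mem_orthogonal' _ _).1 h ((hY i).toLp) (Submodule.subset_span ⟨i, rfl⟩)
  rw [← hc, L2.inner_def] at h'
  rw [← h']
  refine integral_congr_ae ?_
  have hsum : ∀ᵐ ω ∂μ, (∑ j, c j • (hY j).toLp : Lp ℝ 2 μ) ω = ∑ j, c j * Y j ω := by
    have h1 := Lp.coeFn_finsetSum Finset.univ (fun j => c j • (hY j).toLp)
    have h2 : ∀ᵐ ω ∂μ, ∀ j, (c j • (hY j).toLp : Lp ℝ 2 μ) ω = c j * Y j ω := by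
      refine ae_all_iff.2 fun j => ?_
      filter_upwards [Lp.coeFn_smul (c j) (hY j).toLp, (hY j).coeFn_toLp] with ω h1 h2
      simp [h1, h2]
    filter_upwards [h1, h2] with ω h1 h2
    rw [h1, Finset.sum_apply, Finset.sum_congr rfl fun j _ => h2 j]
  filter_upwards [hsum, Lp.coeFn_sub hf.toLp (∑ j, c j • (hY j).toLp), hf.coeFn_toLp,
    (hY i).coeFn_toLp] with ω h1 h2 h3 h4
  rw [h2, Pi.sub_apply, h1, h3, h4]
  simp [mul_comm]

/-- The residual of the linear projection is orthogonal to `Y`, hence independent of it, so its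
conditional mean is zero. The best estimate is thus the linear one. -/
theorem ProbabilityTheory.IsGaussianProcess.condExp_mem_aeSpan (hX : IsGaussianProcess X μ)
    (h0 : ∀ t, ∫ ω, X t ω ∂μ = 0) {ι : Type*} [Finite ι] {f : Ω → ℝ} {Y : ι → Ω → ℝ}
    (hf : f ∈ _root_.aeSpan μ X) (hY : ∀ i, Y i ∈ _root_.aeSpan μ X) (hYm : ∀ i, Measurable (Y i)) :
    μ[f | MeasurableSpace.comap (fun ω i => Y i ω) inferInstance] ∈ _root_.aeSpan μ X := by
  have := hX.isProbabilityMeasure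
  let := Fintype.ofFinite ι
  obtain ⟨c, hc⟩ := exists_integral_sub_sum_mul_eq_zero (hX.memLp_two_of_mem_aeSpan hf)
    fun i => hX.memLp_two_of_mem_aeSpan (hY i)
  set p : Ω → ℝ := ∑ j, c j • Y j with hp
  have hpmem : p ∈ _root_.aeSpan μ X :=
    Submodule.sum_mem _ fun j _ => Submodule.smul_mem _ _ (hY j)
  have hfp := sub_mem hf hpmem
  have hind := hX.indepFun_of_mem_aeSpan h0 (Z := fun _ : Unit => f - p) (fun _ => hfp) hY
    fun _ i => by simpa [hp] using hc i
  have hYm' : Measurable fun ω i => Y i ω := measurable_pi_lambda _ hYm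
  have hpm : Measurable[MeasurableSpace.comap (fun ω i => Y i ω) inferInstance] p := by
    have : p = (fun y : ι → ℝ => ∑ j, c j * y j) ∘ fun ω i => Y i ω := by ext; simp [hp]
    rw [this]
    exact Measurable.comp (by fun_prop) (comap_measurable _)
  have hint : Integrable (f - p) μ := (hX.memLp_two_of_mem_aeSpan hfp).integrable one_le_two
  have hpi : Integrable p μ := (hX.memLp_two_of_mem_aeSpan hpmem).integrable one_le_two
  have hz : μ[f - p | MeasurableSpace.comap (fun ω i => Y i ω) inferInstance] =ᵐ[μ] 0 := by
    -- The residual is only a.e. measurable, whereas `condExp_indep_eq` asks for a σ-algebra below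
    -- the ambient one; hence a measurable version.
    have hae := hint.aestronglyMeasurable.ae_eq_mk
    have hind' := (hind.comp (measurable_pi_apply ()) measurable_id).congr
      (f' := hint.aestronglyMeasurable.mk) hae .rfl
    refine (condExp_congr_ae hae).trans ?_
    have hm := hint.aestronglyMeasurable.stronglyMeasurable_mk.measurable
    refine (condExp_indep_eq hm.comap_le hYm'.comap_le
      (comap_measurable _).stronglyMeasurable hind').trans ?_
    rw [← integral_congr_ae hae, hX.integral_eq_zero_of_mem_aeSpan h0 hfp]
    rfl
  refine mem_aeSpan_of_ae_eq ?_ hpmem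
  have hadd := condExp_add hint hpi (MeasurableSpace.comap (fun ω i => Y i ω) inferInstance)
  rw [sub_add_cancel, condExp_of_stronglyMeasurable hYm'.comap_le hpm.stronglyMeasurable hpi] at hadd
  filter_upwards [hadd, hz] with ω h1 h2
  simp [h1, h2]

/-- A Gaussian characteristic function depends only on the mean and variance of each functional; the
means are zero and the variances ignore the sign. -/
theorem ProbabilityTheory.IsGaussianProcess.map_neg_of_mem_aeSpan (hX : IsGaussianProcess X μ)
    (h0 : ∀ t, ∫ ω, X t ω ∂μ = 0) {ι : Type*} [Fintype ι] {Z : ι → Ω → ℝ}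
    (hZ : ∀ i, Z i ∈ _root_.aeSpan μ X) :
    μ.map (fun ω => -(fun i => Z i ω)) = μ.map (fun ω i => Z i ω) := by
  have := hX.isProbabilityMeasure
  have hG : HasGaussianLaw (fun ω i => Z i ω) μ := by
    have := ((hX.of_mem_aeSpan hZ).hasGaussianLaw Finset.univ).map
      (ContinuousLinearMap.pi fun i => ContinuousLinearMap.proj
        (R := ℝ) (φ := fun _ : (Finset.univ : Finset ι) => ℝ) ⟨i, Finset.mem_univ i⟩)
    exact this
  have hm := hG.aemeasurable
  have : IsFiniteMeasure (μ.map (fun ω => -(fun i => Z i ω))) := inferInstance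
  refine Measure.ext_of_charFunDual ?_
  ext L
  rw [hG.fun_neg.charFunDual_map_eq_fun, hG.charFunDual_map_eq_fun]
  have hL : (fun ω => L (fun i => Z i ω)) ∈ _root_.aeSpan μ X := by
    classical
    have h : (fun ω => L (fun i => Z i ω)) = ∑ i, L (fun j => if i = j then 1 else 0) • Z i := by
      ext ω
      have := LinearMap.pi_apply_eq_sum_univ (L : (ι → ℝ) →ₗ[ℝ] ℝ) fun i => Z i ω
      simpa [mul_comm] using this
    rw [h]
    exact Submodule.sum_mem _ fun i _ => Submodule.smul_mem _ _ (hZ i)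
  have h1 := hX.integral_eq_zero_of_mem_aeSpan h0 hL
  simp only [map_neg, integral_neg, h1, variance_fun_neg]
  simp

theorem ProbabilityTheory.IsGaussianProcess.integral_comp_eq_zero_of_odd
    (hX : IsGaussianProcess X μ) (h0 : ∀ t, ∫ ω, X t ω ∂μ = 0) {ι : Type*} [Fintype ι]
    {Z : ι → Ω → ℝ} (hZ : ∀ i, Z i ∈ _root_.aeSpan μ X) {φ : (ι → ℝ) → ℝ} (hφ : Measurable φ)
    (hodd : ∀ z, φ (-z) = -φ z) : ∫ ω, φ (fun i => Z i ω) ∂μ = 0 := by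
  have hm : AEMeasurable (fun ω i => Z i ω) μ := aemeasurable_pi_lambda _ fun i =>
    (hX.memLp_two_of_mem_aeSpan (hZ i)).aestronglyMeasurable.aemeasurable
  have h1 := integral_map hm (f := φ) hφ.aestronglyMeasurable
  have h2 := integral_map hm.neg (f := φ) hφ.aestronglyMeasurable
  have h3 := hX.map_neg_of_mem_aeSpan h0 hZ
  change μ.map (-fun ω i => Z i ω) = _ at h3
  rw [h3, h1] at h2
  simp only [Pi.neg_apply, hodd, integral_neg] at h2
  linarith

end GaussianSpace

/-! ### Matrices, coordinates and conditional expectations of vectors -/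

theorem toEuclideanLin_coord {a b : ℕ} (B : Matrix (Fin a) (Fin b) ℝ) (z : Vec b) (i : Fin a) :
    B.toEuclideanLin z i = ∑ j, B i j * z j := by
  simp [Matrix.toLpLin_apply, Matrix.mulVec, dotProduct]

theorem continuous_toEuclideanLin {a b : ℕ} (B : Matrix (Fin a) (Fin b) ℝ) :
    Continuous B.toEuclideanLin := LinearMap.continuous_of_finiteDimensional _

theorem measurable_toEuclideanLin {a b : ℕ} (B : Matrix (Fin a) (Fin b) ℝ) :
    Measurable B.toEuclideanLin := (continuous_toEuclideanLin B).measurable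

theorem toEuclideanLin_pow_succ {a : ℕ} (B : Matrix (Fin a) (Fin a) ℝ) (d : ℕ) (z : Vec a) :
    (B ^ (d + 1)).toEuclideanLin z = B.toEuclideanLin ((B ^ d).toEuclideanLin z) := by
  rw [pow_succ']
  simp [Matrix.toLpLin_apply]

section CondExp

variable {Ω : Type*} {H mΩ : MeasurableSpace Ω} {μ : Measure Ω}

theorem condExp_toEuclideanLin {a b : ℕ} (B : Matrix (Fin a) (Fin b) ℝ) {f : Ω → Vec b}
    (hf : Integrable f μ) :
    μ[fun s => B.toEuclideanLin (f s) | H] =ᵐ[μ] fun s => B.toEuclideanLin (μ[f | H] s) :=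
  (B.toEuclideanLin.toContinuousLinearMap.comp_condExp_comm hf).symm

theorem integrable_toEuclideanLin {a b : ℕ} (B : Matrix (Fin a) (Fin b) ℝ) {f : Ω → Vec b}
    (hf : Integrable f μ) : Integrable (fun s => B.toEuclideanLin (f s)) μ :=
  B.toEuclideanLin.toContinuousLinearMap.integrable_comp hf

theorem condExp_coord {d : ℕ} {f : Ω → Vec d} (hf : Integrable f μ) (c : Fin d) :
    μ[fun s => f s c | H] =ᵐ[μ] fun s => μ[f | H] s c :=
  ((EuclideanSpace.proj c : Vec d →L[ℝ] ℝ).comp_condExp_comm hf).symm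

theorem MeasureTheory.Integrable.coord {d : ℕ} {f : Ω → Vec d} (hf : Integrable f μ) (c : Fin d) :
    Integrable (fun s => f s c) μ :=
  (EuclideanSpace.proj c : Vec d →L[ℝ] ℝ).integrable_comp hf

theorem integrable_of_coord {d : ℕ} {f : Ω → Vec d} (hf : ∀ c, Integrable (fun s => f s c) μ) :
    Integrable f μ := by
  have h : f = fun s => ∑ c, f s c • EuclideanSpace.basisFun (Fin d) ℝ c := by
    ext1 s
    exact ((EuclideanSpace.basisFun (Fin d) ℝ).sum_repr (f s)).symm
  rw [h]
  exact integrable_finsetSum _ fun c _ => (hf c).smul_const _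

theorem integral_coord {d : ℕ} {f : Ω → Vec d} (hf : Integrable f μ) (c : Fin d) :
    ∫ s, f s c ∂μ = (∫ s, f s ∂μ) c :=
  (EuclideanSpace.proj c : Vec d →L[ℝ] ℝ).integral_comp_comm hf

/-- A conditional expectation may replace a function that is tested against a measurable one. -/
theorem integral_condExp_mul (hH : H ≤ mΩ) [SigmaFinite (μ.trim hH)] {f g : Ω → ℝ}
    (hg : StronglyMeasurable[H] g) (hfg : Integrable (f * g) μ) (hf : Integrable f μ) :
    ∫ s, μ[f | H] s * g s ∂μ = ∫ s, f s * g s ∂μ := by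
  have h := condExp_mul_of_stronglyMeasurable_right hg hfg hf
  rw [← integral_condExp hH (f := fun s => f s * g s)]
  exact integral_congr_ae h.symm

end CondExp

/-! ### The linear Gaussian system and the increments of the local estimates -/

namespace RemoteEstimation

variable {n m : ℕ} {Ω : Type*}

/-- The dimensions of the initial state, the process noises and the measurement noises. -/
def noiseDim (n m : ℕ) : Unit ⊕ ℕ ⊕ ℕ → ℕ
  | .inl _ => n
  | .inr (.inl _) => n
  | .inr (.inr _) => m

/-- The initial state, the process noises and the measurement noises as one family. -/
def noise (M : RemoteEstimation n m Ω) : ∀ i, Ω → Vec (noiseDim n m i)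
  | .inl _ => M.x₀
  | .inr (.inl j) => M.w j
  | .inr (.inr j) => M.v j

/-- The coordinates of the initial state and of the noises. -/
def noiseCoord (M : RemoteEstimation n m Ω) (p : Σ i, Fin (noiseDim n m i)) (s : Ω) : ℝ :=
  M.noise p.1 s p.2

/-- The σ-algebra generated by the initial state and all the noises. -/
@[reducible] def noiseInfo (M : RemoteEstimation n m Ω) : MeasurableSpace Ω :=
  ⨆ i, MeasurableSpace.comap (M.noise i) inferInstance

theorem noiseInfo_le_channelPast (M : RemoteEstimation n m Ω) (k : ℕ) :
    M.noiseInfo ≤ M.channelPast k := by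
  refine iSup_le fun i => le_sup_of_le_left ?_
  match i with
  | .inl _ => exact le_sup_of_le_left le_sup_left
  | .inr (.inl j) =>
    exact le_sup_of_le_left (le_sup_of_le_right
      (le_iSup (fun j => MeasurableSpace.comap (M.w j) inferInstance) j))
  | .inr (.inr j) =>
    exact le_sup_of_le_right (le_iSup (fun j => MeasurableSpace.comap (M.v j) inferInstance) j)

theorem comap_γ_le_channelPast (M : RemoteEstimation n m Ω) {i k : ℕ} (hi : 1 ≤ i) (hk : i < k) :
    MeasurableSpace.comap (M.γ i) inferInstance ≤ M.channelPast k :=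
  le_sup_of_le_right (le_iSup₂_of_le i (Finset.mem_Ico.2 ⟨hi, hk⟩) le_rfl)

theorem measurable_x_noise (M : RemoteEstimation n m Ω) {N : MeasurableSpace Ω} (k : ℕ)
    (h0 : Measurable[N] M.x₀) (hw : ∀ j < k, Measurable[N] (M.w j)) : Measurable[N] (M.x k) := by
  induction k with
  | zero => exact h0
  | succ k ih =>
    exact ((measurable_toEuclideanLin M.A).comp (ih fun j hj => hw j (by omega))).add
      (hw k (by omega))

theorem measurable_y_noise (M : RemoteEstimation n m Ω) {N : MeasurableSpace Ω} (k : ℕ)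
    (h0 : Measurable[N] M.x₀) (hw : ∀ j < k, Measurable[N] (M.w j))
    (hv : Measurable[N] (M.v k)) : Measurable[N] (M.y k) :=
  ((measurable_toEuclideanLin M.C).comp (M.measurable_x_noise k h0 hw)).add hv

theorem measurable_noise_noiseInfo (M : RemoteEstimation n m Ω) (i) :
    Measurable[M.noiseInfo] (M.noise i) :=
  measurable_iff_comap_le.2 (le_iSup (fun i => MeasurableSpace.comap (M.noise i) inferInstance) i)

theorem measurable_x_noiseInfo (M : RemoteEstimation n m Ω) (k : ℕ) :
    Measurable[M.noiseInfo] (M.x k) :=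
  M.measurable_x_noise k (M.measurable_noise_noiseInfo (.inl ()))
    fun j _ => M.measurable_noise_noiseInfo (.inr (.inl j))

theorem sensorInfo_le_noiseInfo (M : RemoteEstimation n m Ω) (k : ℕ) :
    M.sensorInfo k ≤ M.noiseInfo :=
  iSup₂_le fun j _ => (M.measurable_y_noise j (M.measurable_noise_noiseInfo (.inl ()))
    (fun i _ => M.measurable_noise_noiseInfo (.inr (.inl i)))
    (M.measurable_noise_noiseInfo (.inr (.inr j)))).comap_le

theorem sensorInfo_mono (M : RemoteEstimation n m Ω) : Monotone M.sensorInfo :=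
  fun _ _ h => biSup_mono fun _ hj =>
    Finset.mem_Icc.2 ⟨(Finset.mem_Icc.1 hj).1, (Finset.mem_Icc.1 hj).2.trans h⟩

/-- Presents the information of the sensor as that of one finite real family, the form in which the
Gaussian lemmas apply. -/
theorem comap_y_eq_sensorInfo (M : RemoteEstimation n m Ω) (k : ℕ) :
    MeasurableSpace.comap (fun s (p : Finset.Icc 1 k × Fin m) => M.y p.1 s p.2) inferInstance
      = M.sensorInfo k := by
  refine le_antisymm ?_ (iSup₂_le fun j hj => ?_)
  · refine Measurable.comap_le (@measurable_pi_lambda _ _ _ (M.sensorInfo k) _ _ fun p => ?_)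
    have h : Measurable[M.sensorInfo k] (M.y p.1) := measurable_iff_comap_le.2
      (le_iSup₂ (f := fun j (_ : j ∈ Finset.Icc 1 k) =>
        MeasurableSpace.comap (M.y j) inferInstance) p.1.1 p.1.2)
    exact Measurable.comp (g := fun z : Vec m => z p.2) (by fun_prop) h
  · have h : M.y j = (fun z : Finset.Icc 1 k × Fin m → ℝ =>
        (WithLp.toLp 2 fun c => z (⟨j, hj⟩, c) : Vec m)) ∘
        fun s (p : Finset.Icc 1 k × Fin m) => M.y p.1 s p.2 := by
      ext; rfl
    rw [h]
    exact Measurable.comap_le (Measurable.comp (by fun_prop) (comap_measurable _))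

variable [MeasurableSpace Ω] {μ : Measure Ω} {M : RemoteEstimation n m Ω}

theorem stronglyMeasurable_localEst (M : RemoteEstimation n m Ω) (μ : Measure Ω) (k : ℕ) :
    StronglyMeasurable[M.sensorInfo k] (M.localEst μ k) := stronglyMeasurable_condExp


theorem IsModel.measurable_noise (hM : M.IsModel μ) (i) : Measurable (M.noise i) := by
  match i with
  | .inl _ => exact hM.measurable_x₀
  | .inr (.inl j) => exact hM.measurable_w j
  | .inr (.inr j) => exact hM.measurable_v j

theorem IsModel.noiseInfo_le (hM : M.IsModel μ) : M.noiseInfo ≤ ‹MeasurableSpace Ω› :=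
  iSup_le fun i => (hM.measurable_noise i).comap_le

theorem IsModel.sensorInfo_le (hM : M.IsModel μ) (k : ℕ) :
    M.sensorInfo k ≤ ‹MeasurableSpace Ω› :=
  (M.sensorInfo_le_noiseInfo k).trans hM.noiseInfo_le

theorem IsModel.channelPast_le (hM : M.IsModel μ) (k : ℕ) :
    M.channelPast k ≤ ‹MeasurableSpace Ω› :=
  sup_le (sup_le (sup_le hM.measurable_x₀.comap_le (iSup_le fun j => (hM.measurable_w j).comap_le))
    (iSup_le fun j => (hM.measurable_v j).comap_le))
    (iSup₂_le fun j _ => (hM.measurable_γ j).comap_le)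

theorem IsModel.iIndepFun_noise (hM : M.IsModel μ) : iIndepFun M.noise μ := by
  have h := hM.indep
  rw [iIndepFun_iff_iIndep]
  convert h using 1
  ext1 i
  match i with
  | .inl _ => rfl
  | .inr (.inl j) => rfl
  | .inr (.inr j) => rfl

theorem IsModel.hasGaussianLaw_noise (hM : M.IsModel μ) (i) : HasGaussianLaw (M.noise i) μ := by
  match i with
  | .inl _ => exact hM.hasLaw_x₀.hasGaussianLaw
  | .inr (.inl j) => exact (hM.hasLaw_w j).hasGaussianLaw
  | .inr (.inr j) => exact (hM.hasLaw_v j).hasGaussianLaw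

theorem IsModel.integral_noise (hM : M.IsModel μ) (i) : ∫ s, M.noise i s ∂μ = 0 := by
  match i with
  | .inl _ => exact hM.hasLaw_x₀.integral_eq.trans integral_id_multivariateGaussian
  | .inr (.inl j) => exact (hM.hasLaw_w j).integral_eq.trans integral_id_multivariateGaussian
  | .inr (.inr j) => exact (hM.hasLaw_v j).integral_eq.trans integral_id_multivariateGaussian

theorem IsModel.integral_noiseCoord (hM : M.IsModel μ) (p) : ∫ s, M.noiseCoord p s ∂μ = 0 := by
  have := integral_coord (hM.hasGaussianLaw_noise p.1).integrable p.2
  rw [hM.integral_noise] at this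
  exact this

/-- Finitely many coordinates involve finitely many noises, which are jointly Gaussian by
independence; the coordinates are a linear image. -/
theorem IsModel.isGaussianProcess_noiseCoord (hM : M.IsModel μ) :
    IsGaussianProcess M.noiseCoord μ where
  hasGaussianLaw I := by
    classical
    let J := I.image Sigma.fst
    have h := (hM.iIndepFun_noise.precomp (g := fun j : J => j.1)
      Subtype.val_injective).hasGaussianLaw fun j => hM.hasGaussianLaw_noise j.1
    have hJ (p : I) : p.1.1 ∈ J := Finset.mem_image_of_mem _ p.2
    exact h.map (ContinuousLinearMap.pi fun p : I =>
      (EuclideanSpace.proj p.1.2 : Vec (noiseDim n m p.1.1) →L[ℝ] ℝ).comp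
        (ContinuousLinearMap.proj (R := ℝ) (φ := fun j : J => Vec (noiseDim n m j)) ⟨p.1.1, hJ p⟩))

/-- The space of the linear statistics of the noises, up to null sets. -/
abbrev linStat (M : RemoteEstimation n m Ω) (μ : Measure Ω) : Submodule ℝ (Ω → ℝ) :=
  aeSpan μ M.noiseCoord

theorem noise_mem_linStat (M : RemoteEstimation n m Ω) (μ : Measure Ω) (i) (c) :
    (fun s => M.noise i s c) ∈ M.linStat μ :=
  self_mem_aeSpan (X := M.noiseCoord) ⟨i, c⟩

theorem toEuclideanLin_mem_linStat {a b : ℕ} (B : Matrix (Fin a) (Fin b) ℝ) {f : Ω → Vec b}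
    (hf : ∀ c, (fun s => f s c) ∈ M.linStat μ) (c : Fin a) :
    (fun s => B.toEuclideanLin (f s) c) ∈ M.linStat μ := by
  have h : (fun s => B.toEuclideanLin (f s) c) = ∑ j, B c j • fun s => f s j := by
    ext s
    simp [toEuclideanLin_coord]
  rw [h]
  exact Submodule.sum_mem _ fun j _ => Submodule.smul_mem _ _ (hf j)

theorem x_mem_linStat (M : RemoteEstimation n m Ω) (μ : Measure Ω) (k : ℕ) (c : Fin n) :
    (fun s => M.x k s c) ∈ M.linStat μ := by
  induction k generalizing c with
  | zero => exact M.noise_mem_linStat μ (.inl ()) c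
  | succ k ih =>
    exact add_mem (toEuclideanLin_mem_linStat M.A ih c)
      (M.noise_mem_linStat μ (.inr (.inl k)) c)

theorem y_mem_linStat (M : RemoteEstimation n m Ω) (μ : Measure Ω) (k : ℕ) (c : Fin m) :
    (fun s => M.y k s c) ∈ M.linStat μ :=
  add_mem (toEuclideanLin_mem_linStat M.C (M.x_mem_linStat μ k) c)
    (M.noise_mem_linStat μ (.inr (.inr k)) c)

theorem IsModel.integrable_of_mem_linStat (hM : M.IsModel μ) {f : Ω → ℝ}
    (hf : f ∈ M.linStat μ) : Integrable f μ :=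
  have := hM.isGaussianProcess_noiseCoord.isProbabilityMeasure
  (hM.isGaussianProcess_noiseCoord.memLp_two_of_mem_aeSpan hf).integrable one_le_two

theorem IsModel.integrable_x (hM : M.IsModel μ) (k : ℕ) : Integrable (M.x k) μ :=
  integrable_of_coord fun c => hM.integrable_of_mem_linStat (M.x_mem_linStat μ k c)

theorem IsModel.measurable_y (hM : M.IsModel μ) (k : ℕ) : Measurable (M.y k) :=
  M.measurable_y_noise k hM.measurable_x₀ (fun j _ => hM.measurable_w j) (hM.measurable_v k)

theorem IsModel.localEst_mem_linStat (hM : M.IsModel μ) (k : ℕ) (c : Fin n) :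
    (fun s => M.localEst μ k s c) ∈ M.linStat μ := by
  refine mem_aeSpan_of_ae_eq (condExp_coord (hM.integrable_x k) c).symm ?_
  rw [← M.comap_y_eq_sensorInfo]
  refine hM.isGaussianProcess_noiseCoord.condExp_mem_aeSpan hM.integral_noiseCoord
    (M.x_mem_linStat μ k c) (fun p => M.y_mem_linStat μ p.1 p.2) fun p => ?_
  exact Measurable.comp (g := fun z : Vec m => z p.2) (by fun_prop) (hM.measurable_y _)

theorem IsModel.integrable_localEst (_hM : M.IsModel μ) (k : ℕ) :
    Integrable (M.localEst μ k) μ := integrable_condExp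

/-- The increment `x̂ˢ k - A ^ (k - j) x̂ˢ j` of the local estimates. -/
noncomputable def increment (M : RemoteEstimation n m Ω) (μ : Measure Ω) (j k : ℕ) (s : Ω) :
    Vec n :=
  M.localEst μ k s - (M.A ^ (k - j)).toEuclideanLin (M.localEst μ j s)

theorem IsModel.increment_mem_linStat (hM : M.IsModel μ) (j k : ℕ) (c : Fin n) :
    (fun s => M.increment μ j k s c) ∈ M.linStat μ :=
  sub_mem (hM.localEst_mem_linStat k c)
    (toEuclideanLin_mem_linStat _ (hM.localEst_mem_linStat j) c)

theorem IsModel.integrable_increment (hM : M.IsModel μ) (j k : ℕ) :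
    Integrable (M.increment μ j k) μ :=
  integrable_of_coord fun c => hM.integrable_of_mem_linStat (hM.increment_mem_linStat j k c)

theorem stronglyMeasurable_increment (M : RemoteEstimation n m Ω) (μ : Measure Ω) {j k : ℕ}
    (h : j ≤ k) : StronglyMeasurable[M.sensorInfo k] (M.increment μ j k) :=
  (M.stronglyMeasurable_localEst μ k).sub ((continuous_toEuclideanLin _).comp_stronglyMeasurable
    ((M.stronglyMeasurable_localEst μ j).mono (M.sensorInfo_mono h)))

theorem IsModel.condExp_w (hM : M.IsModel μ) {j k : ℕ} (h : j ≤ k) :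
    μ[M.w k | M.sensorInfo j] =ᵐ[μ] 0 := by
  have := hM.isGaussianProcess_noiseCoord.isProbabilityMeasure
  have hind := indep_iSup_of_disjoint (fun i => (hM.measurable_noise i).comap_le)
    hM.iIndepFun_noise.iIndep (S := {.inr (.inl k)}) (T := {.inr (.inl k)}ᶜ) disjoint_compl_right
  -- The measurement `y l` involves only `w i` with `i < l ≤ j ≤ k`, never `w k`.
  have hle : M.sensorInfo j ≤ ⨆ i ∈ ({.inr (.inl k)}ᶜ : Set (Unit ⊕ ℕ ⊕ ℕ)),
      MeasurableSpace.comap (M.noise i) inferInstance := by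
    have hmeas (i) (hi : i ∈ ({.inr (.inl k)}ᶜ : Set (Unit ⊕ ℕ ⊕ ℕ))) :
        Measurable[⨆ i ∈ ({.inr (.inl k)}ᶜ : Set (Unit ⊕ ℕ ⊕ ℕ)),
          MeasurableSpace.comap (M.noise i) inferInstance] (M.noise i) :=
      measurable_iff_comap_le.2 (le_iSup₂_of_le i hi le_rfl)
    refine iSup₂_le fun l hl => Measurable.comap_le ?_
    have := (Finset.mem_Icc.1 hl).2
    refine M.measurable_y_noise l (hmeas (.inl ()) (by simp))
      (fun i hi => hmeas (.inr (.inl i)) ?_) (hmeas (.inr (.inr l)) (by simp))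
    simp; omega
  have hind' := indep_of_indep_of_le_right hind hle
  rw [iSup_singleton] at hind'
  have h' := condExp_indep_eq (hM.measurable_w k).comap_le (hM.sensorInfo_le j)
    (comap_measurable (M.w k)).stronglyMeasurable hind'
  have h0 := hM.integral_noise (.inr (.inl k))
  change ∫ s, M.w k s ∂μ = 0 at h0
  rw [h0] at h'
  exact h'

theorem IsModel.condExp_x (hM : M.IsModel μ) {j k : ℕ} (h : j ≤ k) :
    μ[M.x k | M.sensorInfo j] =ᵐ[μ]
      fun s => (M.A ^ (k - j)).toEuclideanLin (M.localEst μ j s) := by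
  induction k, h using Nat.le_induction with
  | base =>
    refine Filter.EventuallyEq.of_eq ?_
    ext1 s
    simp [localEst]
  | succ k hk ih =>
    have h1 := condExp_add (m := M.sensorInfo j) (integrable_toEuclideanLin M.A (hM.integrable_x k))
      (hM.hasGaussianLaw_noise (.inr (.inl k))).integrable
    filter_upwards [h1, condExp_toEuclideanLin (H := M.sensorInfo j) M.A (hM.integrable_x k),
      hM.condExp_w hk, ih] with s h1 h2 h3 h4
    rw [show k + 1 - j = k - j + 1 by omega, toEuclideanLin_pow_succ, ← h4, ← h2]
    change _ = _ + μ[M.w k | M.sensorInfo j] s at h1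
    rw [h3, Pi.zero_apply, add_zero] at h1
    exact h1

/-- By the tower property both terms have conditional mean `A ^ (k - j) x̂ˢ j`. -/
theorem IsModel.condExp_increment (hM : M.IsModel μ) {j k : ℕ} (h : j ≤ k) :
    μ[M.increment μ j k | M.sensorInfo j] =ᵐ[μ] 0 := by
  have := hM.isGaussianProcess_noiseCoord.isProbabilityMeasure
  have h1 := condExp_sub (m := M.sensorInfo j) (hM.integrable_localEst k)
    (integrable_toEuclideanLin (M.A ^ (k - j)) (hM.integrable_localEst j))
  have h2 : μ[M.localEst μ k | M.sensorInfo j] =ᵐ[μ] μ[M.x k | M.sensorInfo j] :=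
    condExp_condExp_of_le (M.sensorInfo_mono h) (hM.sensorInfo_le k)
  rw [condExp_of_stronglyMeasurable (hM.sensorInfo_le j)
    ((continuous_toEuclideanLin _).comp_stronglyMeasurable (M.stronglyMeasurable_localEst μ j))
    (integrable_toEuclideanLin (M.A ^ (k - j)) (hM.integrable_localEst j))] at h1
  filter_upwards [h1, h2, hM.condExp_x h] with s h1 h2 h3
  refine h1.trans ?_
  simp [h2, h3]

theorem IsModel.integral_increment_mul_y (hM : M.IsModel μ) {j k l : ℕ} (h : j ≤ k)
    (hl : l ∈ Finset.Icc 1 j) (c : Fin n) (d : Fin m) :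
    ∫ s, M.increment μ j k s c * M.y l s d ∂μ = 0 := by
  have := hM.isGaussianProcess_noiseCoord.isProbabilityMeasure
  have hy : Measurable[M.sensorInfo j] fun s => M.y l s d := by
    have h : Measurable[M.sensorInfo j] (M.y l) := measurable_iff_comap_le.2
      (le_iSup₂ (f := fun j' (_ : j' ∈ Finset.Icc 1 j) =>
        MeasurableSpace.comap (M.y j') inferInstance) l hl)
    exact Measurable.comp (g := fun z : Vec m => z d) (by fun_prop) h
  have hG := hM.isGaussianProcess_noiseCoord
  have hint : Integrable ((fun s => M.increment μ j k s c) * fun s => M.y l s d) μ :=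
    (hG.memLp_two_of_mem_aeSpan (hM.increment_mem_linStat j k c)).integrable_mul
    (hG.memLp_two_of_mem_aeSpan (M.y_mem_linStat μ l d))
  rw [← integral_condExp_mul (f := fun s => M.increment μ j k s c) (hM.sensorInfo_le j)
    hy.stronglyMeasurable hint ((hM.integrable_increment j k).coord c)]
  refine integral_eq_zero_of_ae ?_
  filter_upwards [condExp_coord (H := M.sensorInfo j) (hM.integrable_increment j k) c,
    hM.condExp_increment h] with s h1 h2
  simp [h1, h2]

/-- Joint independence of a whole family of increments is needed, since the losses after time `j`
depend on all of them. -/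
theorem IsModel.indepFun_increment_y (hM : M.IsModel μ) (j : ℕ) {ι : Type*} {t : ι → ℕ}
    (ht : ∀ i, j ≤ t i) :
    IndepFun (fun s (p : ι × Fin n) => M.increment μ j (t p.1) s p.2)
      (fun s (p : Finset.Icc 1 j × Fin m) => M.y p.1 s p.2) μ :=
  hM.isGaussianProcess_noiseCoord.indepFun_of_mem_aeSpan hM.integral_noiseCoord
    (Z := fun (p : ι × Fin n) s => M.increment μ j (t p.1) s p.2)
    (Y := fun (p : Finset.Icc 1 j × Fin m) s => M.y p.1 s p.2)
    (fun p => hM.increment_mem_linStat j _ p.2) (fun p => M.y_mem_linStat μ p.1 p.2)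
    fun p p' => hM.integral_increment_mul_y (ht p.1) p'.1.2 p.2 p'.2

/-- An odd function of the increments after time `j` is orthogonal to the σ-algebra of the
measurements up to time `j`. -/
theorem IsModel.integral_odd_increment_mul (hM : M.IsModel μ) (j : ℕ) {ι : Type*} [Fintype ι]
    {t : ι → ℕ} (ht : ∀ i, j ≤ t i) {φ : (ι → Vec n) → ℝ} (hφ : Measurable φ)
    (hodd : ∀ z, φ (-z) = -φ z) {g : Ω → ℝ} (hg : Measurable[M.sensorInfo j] g) :
    ∫ s, φ (fun i => M.increment μ j (t i) s) * g s ∂μ = 0 := by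
  let ψ : (ι × Fin n → ℝ) → ℝ := fun z => φ fun i => WithLp.toLp 2 fun c => z (i, c)
  have hψ : Measurable ψ := hφ.comp (by fun_prop)
  have hG := hM.isGaussianProcess_noiseCoord
  have hZ (p : ι × Fin n) := hM.increment_mem_linStat j (t p.1) p.2
  have h0 := hG.integral_comp_eq_zero_of_odd hM.integral_noiseCoord
    (Z := fun (p : ι × Fin n) s => M.increment μ j (t p.1) s p.2) hZ hψ
    fun z => by rw [← hodd]; rfl
  have hind : IndepFun (fun s => ψ fun p => M.increment μ j (t p.1) s p.2) g μ := by
    have h := (hM.indepFun_increment_y j ht).comp hψ measurable_id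
    refine indep_of_indep_of_le_right h ?_
    rw [Function.id_comp, comap_y_eq_sensorInfo]
    exact hg.comap_le
  have hZm : Measurable fun s (p : ι × Fin n) => M.increment μ j (t p.1) s p.2 :=
    measurable_pi_lambda _ fun p => Measurable.comp (g := fun z : Vec n => z p.2) (by fun_prop)
      ((M.stronglyMeasurable_increment μ (ht p.1)).mono (hM.sensorInfo_le _)).measurable
  have h := hind.integral_fun_mul_eq_mul_integral (hψ.comp hZm).aestronglyMeasurable
    (hg.mono (hM.sensorInfo_le j) le_rfl).aestronglyMeasurable
  rw [h0, zero_mul] at h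
  exact h

end RemoteEstimation

/-! ### Arrival patterns and their probabilities given the noises -/

namespace RemoteEstimation

/-- The last element of `G` before `k`. -/
noncomputable def lastArrival (G : Set ℕ) (k : ℕ) : ℕ := sSup {t | t < k ∧ t ∈ G}

theorem bddAbove_arrivals (G : Set ℕ) (k : ℕ) : BddAbove {t | t < k ∧ t ∈ G} :=
  ⟨k, fun _ ht => ht.1.le⟩

theorem le_lastArrival {G : Set ℕ} {t k : ℕ} (h : t < k) (ht : t ∈ G) : t ≤ lastArrival G k :=
  le_csSup (bddAbove_arrivals G k) ⟨h, ht⟩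

theorem lastArrival_mem {G : Set ℕ} (h0 : 0 ∈ G) {k : ℕ} (hk : 1 ≤ k) :
    lastArrival G k < k ∧ lastArrival G k ∈ G :=
  have h : {t | t < k ∧ t ∈ G}.Nonempty := ⟨0, hk, h0⟩
  Nat.sSup_mem h (bddAbove_arrivals G k)

theorem lastArrival_congr {G G' : Set ℕ} {k : ℕ} (h : ∀ t < k, t ∈ G ↔ t ∈ G') :
    lastArrival G k = lastArrival G' k := by
  unfold lastArrival
  congr 1
  ext t
  exact and_congr_right fun ht => h t ht

theorem lastArrival_succ_of_mem {G : Set ℕ} {k : ℕ} (h : k ∈ G) : lastArrival G (k + 1) = k :=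
  IsGreatest.csSup_eq ⟨⟨k.lt_succ_self, h⟩, fun _ ht => Nat.lt_succ_iff.1 ht.1⟩

theorem lastArrival_succ_of_notMem {G : Set ℕ} {k : ℕ} (h : k ∉ G) :
    lastArrival G (k + 1) = lastArrival G k := by
  unfold lastArrival
  congr 1
  ext t
  simp only [Set.mem_ofPred_eq]
  constructor
  · rintro ⟨h1, h2⟩
    exact ⟨lt_of_le_of_ne (Nat.lt_succ_iff.1 h1) fun h' => h (h' ▸ h2), h2⟩
  · exact fun ⟨h1, h2⟩ => ⟨h1.trans k.lt_succ_self, h2⟩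

/-- During a run of losses all innovations are increments from the same base time. -/
theorem lastArrival_eq_of_lt_of_le {G : Set ℕ} (h0 : 0 ∈ G) {i k : ℕ}
    (h1 : lastArrival G k < i) (h2 : i ≤ k) : lastArrival G i = lastArrival G k := by
  have hi := lastArrival_mem h0 (k := i) (by omega)
  have hk := lastArrival_mem h0 (k := k) (by omega)
  exact (le_lastArrival (hi.1.trans_le h2) hi.2).antisymm (le_lastArrival h1 hk.2)

variable {n m : ℕ} {Ω : Type*}

/-- The arrival times of the packets. -/
def arrivals (M : RemoteEstimation n m Ω) (s : Ω) : Set ℕ := {t | M.γ t s = 1}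

/-- The probability that a packet is lost at holding time `t`, as a function of the incremental
innovation. -/
noncomputable def dropProb (M : RemoteEstimation n m Ω) (t : ℕ) (z : Vec n) : ℝ :=
  M.q ^ (M.N₀ * M.W / (2 * M.α) * inner ℝ z ((M.weight t).toEuclideanLin z) + M.basePower)

/-- The power is quadratic in the innovation: this evenness is what keeps a loss from revealing a
sign. -/
theorem dropProb_neg (M : RemoteEstimation n m Ω) (t : ℕ) (z : Vec n) :
    M.dropProb t (-z) = M.dropProb t z := by
  simp [dropProb]

theorem measurable_dropProb (M : RemoteEstimation n m Ω) (t : ℕ) : Measurable (M.dropProb t) :=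
  Measurable.const_pow
    (((measurable_id.inner (measurable_toEuclideanLin (M.weight t))).const_mul _).add_const _) _

open Classical in
/-- The probability that the arrival of the packet of time `k` is as prescribed by the pattern `G`,
as a function of the incremental innovation. -/
noncomputable def arrivalProb (M : RemoteEstimation n m Ω) (G : Set ℕ) (k : ℕ) (z : Vec n) : ℝ :=
  if k ∈ G then 1 - M.dropProb (k - lastArrival G k) z else M.dropProb (k - lastArrival G k) z

theorem arrivalProb_neg (M : RemoteEstimation n m Ω) (G : Set ℕ) (k : ℕ) (z : Vec n) :
    M.arrivalProb G k (-z) = M.arrivalProb G k z := by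
  simp [arrivalProb, dropProb_neg]

theorem measurable_arrivalProb (M : RemoteEstimation n m Ω) (G : Set ℕ) (k : ℕ) :
    Measurable (M.arrivalProb G k) := by
  unfold arrivalProb
  split_ifs
  exacts [(M.measurable_dropProb _).const_sub 1, M.measurable_dropProb _]

/-- The event that the arrivals up to time `k` are those of the pattern `G`. -/
def patternEvent (M : RemoteEstimation n m Ω) (G : Set ℕ) (k : ℕ) : Set Ω :=
  {s | ∀ i ≤ k, M.γ i s = 1 ↔ i ∈ G}

theorem patternEvent_succ (M : RemoteEstimation n m Ω) (G : Set ℕ) (k : ℕ) :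
    M.patternEvent G (k + 1) = M.patternEvent G k ∩ {s | M.γ (k + 1) s = 1 ↔ k + 1 ∈ G} := by
  ext s
  constructor
  · exact fun h => ⟨fun i hi => h i (hi.trans k.le_succ), h _ le_rfl⟩
  · rintro ⟨h1, h2⟩ i hi
    rcases Nat.le_succ_iff.1 hi with hi | rfl
    exacts [h1 i hi, h2]

theorem lastArrival_eq_of_mem_patternEvent {M : RemoteEstimation n m Ω} {G : Set ℕ} {k : ℕ}
    {s : Ω} (hs : s ∈ M.patternEvent G k) {i : ℕ} (hi : i ≤ k + 1) :
    lastArrival (M.arrivals s) i = lastArrival G i :=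
  lastArrival_congr fun t ht => hs t (by omega)

variable [MeasurableSpace Ω] {μ : Measure Ω} {M : RemoteEstimation n m Ω}

theorem IsModel.zero_mem_arrivals (hM : M.IsModel μ) (s : Ω) : 0 ∈ M.arrivals s := hM.γ_zero s

theorem IsModel.sub_holdingTime (hM : M.IsModel μ) {k : ℕ} (hk : 1 ≤ k) (s : Ω) :
    k - M.holdingTime k s = lastArrival (M.arrivals s) k :=
  Nat.sub_sub_self (lastArrival_mem (hM.zero_mem_arrivals s) hk).1.le

theorem IsModel.prediction_eq (hM : M.IsModel μ) {k : ℕ} (hk : 1 ≤ k) (s : Ω) :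
    M.prediction μ k s = (M.A ^ (k - lastArrival (M.arrivals s) k)).toEuclideanLin
      (M.localEst μ (lastArrival (M.arrivals s) k) s) := by
  rw [prediction, hM.sub_holdingTime hk]
  rfl

theorem IsModel.innovation_eq (hM : M.IsModel μ) {k : ℕ} (hk : 1 ≤ k) (s : Ω) :
    M.innovation μ k s = M.increment μ (lastArrival (M.arrivals s) k) k s := by
  rw [innovation, increment, hM.prediction_eq hk]

theorem IsModel.q_rpow_power (hM : M.IsModel μ) {k : ℕ} (hk : 1 ≤ k) (s : Ω) :
    M.q ^ M.power μ k s = M.dropProb (k - lastArrival (M.arrivals s) k)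
      (M.increment μ (lastArrival (M.arrivals s) k) k s) := by
  rw [power, hM.innovation_eq hk]
  rfl

theorem IsModel.dropProb_mem (hM : M.IsModel μ) (t : ℕ) (z : Vec n) :
    M.dropProb t z ∈ Set.Icc (0 : ℝ) 1 := by
  have h1 : 0 < M.N₀ * M.W := mul_pos hM.N₀_pos hM.W_pos
  have h2 : 0 ≤ inner ℝ z ((M.weight t).toEuclideanLin z) := by
    have := (Matrix.isPositive_toEuclideanLin_iff.2 (hM.posSemidef_weight t)).re_inner_nonneg_right z
    simpa using this
  have hα := hM.α_pos
  refine ⟨Real.rpow_nonneg (Real.exp_pos _).le _, Real.rpow_le_one (Real.exp_pos _).le ?_ ?_⟩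
  · rw [q, Real.exp_le_one_iff, neg_div]
    have := div_pos hα h1
    linarith
  · have := hM.basePower_nonneg
    positivity

theorem IsModel.arrivalProb_mem (hM : M.IsModel μ) (G : Set ℕ) (k : ℕ) (z : Vec n) :
    M.arrivalProb G k z ∈ Set.Icc (0 : ℝ) 1 := by
  have := hM.dropProb_mem (k - lastArrival G k) z
  unfold arrivalProb
  split_ifs
  · exact ⟨by linarith [this.2], by linarith [this.1]⟩
  · exact this

/-- The conditional probability, given the noises, that the arrival of the packet of time `k` is as
prescribed by the pattern `G`, when so were the earlier ones. -/
noncomputable def transProb (M : RemoteEstimation n m Ω) (μ : Measure Ω) (G : Set ℕ) (k : ℕ)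
    (s : Ω) : ℝ :=
  M.arrivalProb G k (M.increment μ (lastArrival G k) k s)

theorem measurable_transProb (M : RemoteEstimation n m Ω) (μ : Measure Ω) {G : Set ℕ}
    (h0 : 0 ∈ G) {k : ℕ} (hk : 1 ≤ k) : Measurable[M.sensorInfo k] (M.transProb μ G k) :=
  (M.measurable_arrivalProb G k).comp
    (M.stronglyMeasurable_increment μ (lastArrival_mem h0 hk).1.le).measurable

theorem measurable_prod_transProb (M : RemoteEstimation n m Ω) (μ : Measure Ω) {G : Set ℕ}
    (h0 : 0 ∈ G) (k : ℕ) :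
    Measurable[M.sensorInfo k] fun s => ∏ i ∈ Finset.Icc 1 k, M.transProb μ G i s :=
  @Finset.measurable_fun_prod _ _ _ _ _ _ (M.sensorInfo k) _ _ fun _ hi =>
    (M.measurable_transProb μ h0 (Finset.mem_Icc.1 hi).1).mono
      (M.sensorInfo_mono (Finset.mem_Icc.1 hi).2) le_rfl

theorem IsModel.prod_transProb_mem (hM : M.IsModel μ) (G : Set ℕ) (I : Finset ℕ) (s : Ω) :
    ∏ i ∈ I, M.transProb μ G i s ∈ Set.Icc (0 : ℝ) 1 :=
  ⟨Finset.prod_nonneg fun i _ => (hM.arrivalProb_mem G i _).1,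
    Finset.prod_le_one (fun i _ => (hM.arrivalProb_mem G i _).1)
      fun _ _ => (hM.arrivalProb_mem G _ _).2⟩

theorem integrable_mul_of_mem_Icc {f g : Ω → ℝ} (hf : Integrable f μ) (hg : Measurable g)
    (hg' : ∀ s, g s ∈ Set.Icc (0 : ℝ) 1) : Integrable (fun s => f s * g s) μ :=
  hf.mul_bdd (c := 1) hg.aestronglyMeasurable (.of_forall fun s => by
    rw [Real.norm_of_nonneg (hg' s).1]
    exact (hg' s).2)

theorem IsModel.measurableSet_patternEvent_channelPast (hM : M.IsModel μ) (G : Set ℕ) (k : ℕ) :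
    MeasurableSet[M.channelPast (k + 1)] (M.patternEvent G k) := by
  have h : M.patternEvent G k = ⋂ i, ⋂ (_ : i ≤ k), {s | M.γ i s = 1 ↔ i ∈ G} := by
    ext; simp [patternEvent]
  rw [h]
  refine MeasurableSet.iInter fun i => MeasurableSet.iInter fun hi => ?_
  rcases Nat.eq_zero_or_pos i with rfl | hi0
  · by_cases h0 : 0 ∈ G <;> simp [hM.γ_zero, h0]
  · have hm : Measurable[M.channelPast (k + 1)] (M.γ i) :=
      measurable_iff_comap_le.2 (M.comap_γ_le_channelPast hi0 (Nat.lt_succ_of_le hi))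
    by_cases h : i ∈ G
    · simp only [h, iff_true]
      exact hm (measurableSet_singleton (1 : ℝ))
    · simp only [h, iff_false]
      exact hm (measurableSet_singleton (1 : ℝ)).compl

theorem IsModel.measurableSet_patternEvent (hM : M.IsModel μ) (G : Set ℕ) (k : ℕ) :
    MeasurableSet (M.patternEvent G k) :=
  hM.channelPast_le _ _ (hM.measurableSet_patternEvent_channelPast G k)

theorem IsModel.γ_ne_one_iff (hM : M.IsModel μ) (k : ℕ) (s : Ω) : M.γ k s ≠ 1 ↔ M.γ k s = 0 := by
  rcases hM.γ_mem k s with h | h <;> simp [h]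

/-- The pattern up to `k` and `f` belong to the channel past of `k + 1`, so the indicator of a loss
may be replaced by its conditional probability. On the pattern event the random last arrival is that
of `G`. -/
theorem IsModel.setIntegral_patternEvent_inter_drop [IsProbabilityMeasure μ]
    (hM : M.IsModel μ) (G : Set ℕ) (k : ℕ)
    {f : Ω → ℝ} (hf : Measurable[M.noiseInfo] f) (hfi : Integrable f μ) :
    ∫ s in M.patternEvent G k ∩ M.γ (k + 1) ⁻¹' {0}, f s ∂μ =
      ∫ s in M.patternEvent G k, f s * M.dropProb (k + 1 - lastArrival G (k + 1))
        (M.increment μ (lastArrival G (k + 1)) (k + 1) s) ∂μ := by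
  have hP := hM.measurableSet_patternEvent G k
  have hD : MeasurableSet (M.γ (k + 1) ⁻¹' {0}) := hM.measurable_γ _ (measurableSet_singleton 0)
  have hg : StronglyMeasurable[M.channelPast (k + 1)] ((M.patternEvent G k).indicator f) :=
    ((hf.mono (M.noiseInfo_le_channelPast _) le_rfl).indicator
      (hM.measurableSet_patternEvent_channelPast G k)).stronglyMeasurable
  have hint : Integrable ((M.γ (k + 1) ⁻¹' {0}).indicator (fun _ => (1 : ℝ)) *
      (M.patternEvent G k).indicator f) μ := by
    refine ((hfi.indicator hP).indicator hD).congr (.of_eq ?_)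
    ext s
    by_cases h1 : s ∈ M.γ (k + 1) ⁻¹' {0} <;> simp [h1]
  have h := integral_condExp_mul (hM.channelPast_le (k + 1)) hg hint
    ((integrable_const _).indicator hD)
  have h1 : ∫ s in M.patternEvent G k ∩ M.γ (k + 1) ⁻¹' {0}, f s ∂μ =
      ∫ s, (M.γ (k + 1) ⁻¹' {0}).indicator (fun _ => (1 : ℝ)) s *
        (M.patternEvent G k).indicator f s ∂μ := by
    rw [← integral_indicator (hP.inter hD)]
    congr with s
    by_cases h1 : s ∈ M.patternEvent G k <;> by_cases h2 : s ∈ M.γ (k + 1) ⁻¹' {0} <;>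
      simp_all
  rw [h1, ← h, ← integral_indicator hP]
  refine integral_congr_ae ?_
  filter_upwards [hM.drop_prob (k + 1) (by omega)] with s hs
  rw [hs, hM.q_rpow_power (by omega)]
  by_cases h1 : s ∈ M.patternEvent G k
  · rw [lastArrival_eq_of_mem_patternEvent h1 le_rfl]
    simp [h1, mul_comm]
  · simp [h1]

/-- Given the noises, a pattern of arrivals has the product of the transition probabilities as its
probability. -/
theorem IsModel.setIntegral_patternEvent [IsProbabilityMeasure μ] (hM : M.IsModel μ)
    {G : Set ℕ} (h0 : 0 ∈ G) (k : ℕ)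
    {f : Ω → ℝ} (hf : Measurable[M.noiseInfo] f) (hfi : Integrable f μ) :
    ∫ s in M.patternEvent G k, f s ∂μ =
      ∫ s, f s * ∏ i ∈ Finset.Icc 1 k, M.transProb μ G i s ∂μ := by
  induction k generalizing f with
  | zero =>
    have : M.patternEvent G 0 = Set.univ := by
      ext s
      simp [patternEvent, hM.γ_zero, h0]
    simp [this]
  | succ k ih =>
    have hTm : Measurable[M.noiseInfo] (M.transProb μ G (k + 1)) :=
      (M.measurable_transProb μ h0 (by omega)).mono (M.sensorInfo_le_noiseInfo _) le_rfl
    have hfT : Integrable (fun s => f s * M.transProb μ G (k + 1) s) μ :=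
      integrable_mul_of_mem_Icc hfi (hTm.mono hM.noiseInfo_le le_rfl)
        fun s => hM.arrivalProb_mem G _ _
    have hstep : ∫ s in M.patternEvent G (k + 1), f s ∂μ =
        ∫ s in M.patternEvent G k, f s * M.transProb μ G (k + 1) s ∂μ := by
      have hdrop := hM.setIntegral_patternEvent_inter_drop G k hf hfi
      rw [patternEvent_succ]
      by_cases hk : k + 1 ∈ G
      · have hset : M.patternEvent G k ∩ {s | M.γ (k + 1) s = 1 ↔ k + 1 ∈ G} =
            M.patternEvent G k \ M.γ (k + 1) ⁻¹' {0} := by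
          ext s
          have := hM.γ_ne_one_iff (k + 1) s
          simp only [Set.mem_inter_iff, Set.mem_ofPred_eq, hk, iff_true, Set.mem_sdiff,
            Set.mem_preimage, Set.mem_singleton_iff]
          tauto
        have hsplit := integral_inter_add_sdiff (s := M.patternEvent G k) (f := f) (μ := μ)
          (hM.measurable_γ (k + 1) (measurableSet_singleton 0)) hfi.integrableOn
        have hdi : Integrable (fun s => f s * M.dropProb (k + 1 - lastArrival G (k + 1))
            (M.increment μ (lastArrival G (k + 1)) (k + 1) s)) μ :=
          integrable_mul_of_mem_Icc hfi ((M.measurable_dropProb _).comp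
            ((M.stronglyMeasurable_increment μ (lastArrival_mem h0 (by omega)).1.le).mono
              (hM.sensorInfo_le _)).measurable) fun s => hM.dropProb_mem _ _
        rw [hset, eq_sub_of_add_eq' hsplit, hdrop, ← integral_sub hfi.integrableOn hdi.integrableOn]
        congr with s
        simp [transProb, arrivalProb, hk, mul_sub]
      · have hset : M.patternEvent G k ∩ {s | M.γ (k + 1) s = 1 ↔ k + 1 ∈ G} =
            M.patternEvent G k ∩ M.γ (k + 1) ⁻¹' {0} := by
          ext s
          have := hM.γ_ne_one_iff (k + 1) s
          simp only [Set.mem_inter_iff, Set.mem_ofPred_eq, hk, iff_false,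
            Set.mem_preimage, Set.mem_singleton_iff]
          tauto
        rw [hset, hdrop]
        congr with s
        simp [transProb, arrivalProb, hk]
    -- The new factor depends on the noises only, so it is absorbed into the integrand, over which
    -- the induction is general.
    rw [hstep, ih (f := fun s => f s * M.transProb μ G (k + 1) s) (hf.mul hTm) hfT]
    congr with s
    rw [Finset.prod_Icc_succ_top (by omega)]
    ring

/-- On a pattern event the information of the remote estimator reduces to measurements. -/
theorem IsModel.exists_measurableSet_sensorInfo_inter_eq (hM : M.IsModel μ) {G : Set ℕ} {j k : ℕ}
    (hj : ∀ i ∈ Finset.Icc 1 k, i ∈ G → i ≤ j) {S : Set Ω} (hS : MeasurableSet[M.remoteInfo μ k] S) :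
    ∃ B, MeasurableSet[M.sensorInfo j] B ∧ S ∩ M.patternEvent G k = B ∩ M.patternEvent G k := by
  let e : M.patternEvent G k → Ω := Subtype.val
  -- Compare traces on the pattern event: there each `γ i` is constant, and `γ i • x̂ˢ i` is `x̂ˢ i`
  -- for `i ∈ G` and `0` otherwise.
  have hle : (M.remoteInfo μ k).comap e ≤ (M.sensorInfo j).comap e := by
    rw [remoteInfo]
    simp_rw [MeasurableSpace.comap_iSup (m := fun i => ⨆ (_ : i ∈ Finset.Icc 1 k), _),
      MeasurableSpace.comap_iSup (ι := _ ∈ _), MeasurableSpace.comap_sup]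
    refine iSup₂_le fun i hi => ?_
    have hik := (Finset.mem_Icc.1 hi).2
    by_cases hiG : i ∈ G
    · have h1 (s : M.patternEvent G k) : M.γ i s = 1 := (s.2 i hik).2 hiG
      refine sup_le ?_ ?_
      · rw [MeasurableSpace.comap_comp, show M.γ i ∘ e = fun _ => 1 from funext h1,
          MeasurableSpace.comap_const]
        exact bot_le
      · rw [MeasurableSpace.comap_comp,
          show (fun s => M.γ i s • M.localEst μ i s) ∘ e = M.localEst μ i ∘ e from
          funext fun s => by simp [e, h1], ← MeasurableSpace.comap_comp]
        exact MeasurableSpace.comap_mono (((M.stronglyMeasurable_localEst μ i).measurable.mono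
          (M.sensorInfo_mono (hj i hi hiG)) le_rfl).comap_le)
    · have h0 (s : M.patternEvent G k) : M.γ i s = 0 :=
        (hM.γ_ne_one_iff i s).1 fun h => hiG ((s.2 i hik).1 h)
      refine sup_le ?_ ?_
      · rw [MeasurableSpace.comap_comp, show M.γ i ∘ e = fun _ => 0 from funext h0,
          MeasurableSpace.comap_const]
        exact bot_le
      · rw [MeasurableSpace.comap_comp,
          show (fun s => M.γ i s • M.localEst μ i s) ∘ e = fun _ => 0 from
          funext fun s => by simp [e, h0], MeasurableSpace.comap_const]
        exact bot_le
  obtain ⟨B, hB, hBS⟩ := hle _ ⟨S, hS, rfl⟩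
  refine ⟨B, hB, ?_⟩
  have := Subtype.preimage_coe_eq_preimage_coe_iff.1 hBS
  rw [Set.inter_comm S, Set.inter_comm B]
  exact this.symm

/-- The subsets of `{0, …, k}` give a finite partition into pattern events; those without `0` are
empty because `γ 0 = 1`. -/
theorem IsModel.setIntegral_eq_zero_of_patternEvent (hM : M.IsModel μ) (k : ℕ) {f : Ω → ℝ}
    (hf : Integrable f μ) {S : Set Ω} (hS : MeasurableSet S)
    (h : ∀ G : Set ℕ, 0 ∈ G → ∫ s in S ∩ M.patternEvent G k, f s ∂μ = 0) :
    ∫ s in S, f s ∂μ = 0 := by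
  classical
  have hcover : S = ⋃ G ∈ (Finset.range (k + 1)).powerset, S ∩ M.patternEvent (G : Set ℕ) k := by
    refine (Set.iUnion₂_subset fun _ _ => Set.inter_subset_left).antisymm' fun s hs => ?_
    refine Set.mem_iUnion₂.2 ⟨(Finset.range (k + 1)).filter fun i => M.γ i s = 1,
      Finset.mem_powerset.2 (Finset.filter_subset _ _), hs, fun i hi => ?_⟩
    simp [hi]
  rw [hcover, integral_biUnion_finset (s := fun G : Finset ℕ => S ∩ M.patternEvent (G : Set ℕ) k) _
    (fun G _ => hS.inter (hM.measurableSet_patternEvent G k)) ?_ fun _ _ => hf.integrableOn]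
  · refine Finset.sum_eq_zero fun G _ => ?_
    by_cases h0 : 0 ∈ (G : Set ℕ)
    · exact h G h0
    · have : M.patternEvent (G : Set ℕ) k = ∅ :=
        Set.eq_empty_of_forall_notMem fun s hs => h0 ((hs 0 k.zero_le).1 (hM.γ_zero s))
      simp [this]
  · intro G hG G' hG' hne
    refine Set.disjoint_left.2 fun s hs hs' => hne ?_
    ext i
    by_cases hi : i ≤ k
    · exact (hs.2 i hi).symm.trans (hs'.2 i hi)
    · have h1 := Finset.mem_powerset.1 (Finset.mem_coe.1 hG)
      have h2 := Finset.mem_powerset.1 (Finset.mem_coe.1 hG')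
      exact iff_of_false (fun h => hi (Nat.lt_succ_iff.1 (Finset.mem_range.1 (h1 h))))
        fun h => hi (Nat.lt_succ_iff.1 (Finset.mem_range.1 (h2 h)))

/-- The symmetry argument. With `j` the last arrival, the factors up to `j` join `g` as functions of
`y 1, …, y j`. The factors after `j` are even in the increments from `j`, so multiplying them by the
increment at `k` gives an odd function. -/
theorem IsModel.integral_increment_mul_prod_transProb (hM : M.IsModel μ) {G : Set ℕ} (h0 : 0 ∈ G)
    {k : ℕ} (hk : 1 ≤ k) (c : Fin n) {g : Ω → ℝ}
    (hg : Measurable[M.sensorInfo (lastArrival G k)] g) :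
    ∫ s, g s * M.increment μ (lastArrival G k) k s c *
      ∏ i ∈ Finset.Icc 1 k, M.transProb μ G i s ∂μ = 0 := by
  set j := lastArrival G k with hj
  have hjk : j < k := (lastArrival_mem h0 hk).1
  let φ : (Finset.Ioc j k → Vec n) → ℝ := fun z =>
    z ⟨k, Finset.mem_Ioc.2 ⟨hjk, le_rfl⟩⟩ c * ∏ i : Finset.Ioc j k, M.arrivalProb G i (z i)
  have hφ : Measurable φ :=
    Measurable.mul (by fun_prop) (Finset.measurable_fun_prod _ fun i _ =>
      (M.measurable_arrivalProb G i).comp (measurable_pi_apply i))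
  have h := hM.integral_odd_increment_mul j (t := fun i : Finset.Ioc j k => (i : ℕ))
    (fun i => (Finset.mem_Ioc.1 i.2).1.le) hφ
    (fun z => by simp [φ, arrivalProb_neg]) (hg.mul (M.measurable_prod_transProb μ h0 j))
  rw [← h]
  congr with s
  have hprod : ∏ i ∈ Finset.Icc 1 k, M.transProb μ G i s =
      (∏ i ∈ Finset.Icc 1 j, M.transProb μ G i s) *
        ∏ i : Finset.Ioc j k, M.arrivalProb G i (M.increment μ j i s) := by
    have hIoc : ∏ i ∈ Finset.Ioc j k, M.arrivalProb G i (M.increment μ j i s) =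
        ∏ i ∈ Finset.Ioc j k, M.transProb μ G i s := Finset.prod_congr rfl fun i hi => by
      have := Finset.mem_Ioc.1 hi
      rw [transProb, lastArrival_eq_of_lt_of_le h0 this.1 this.2]
    rw [Finset.prod_coe_sort (Finset.Ioc j k) fun i => M.arrivalProb G i (M.increment μ j i s),
      hIoc, ← Finset.prod_union]
    · congr 1
      ext i
      simp
      omega
    · exact Finset.disjoint_left.2 fun i h1 h2 => by simp at h1 h2; omega
  rw [hprod]
  simp only [φ, Pi.mul_apply]
  ring

theorem measurable_increment_noiseInfo (M : RemoteEstimation n m Ω) (μ : Measure Ω) {j k : ℕ}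
    (h : j ≤ k) (c : Fin n) : Measurable[M.noiseInfo] fun s => M.increment μ j k s c :=
  Measurable.comp (g := fun z : Vec n => z c) (by fun_prop)
    ((M.stronglyMeasurable_increment μ h).measurable.mono (M.sensorInfo_le_noiseInfo k) le_rfl)

end RemoteEstimation

/-! ### The remote estimator -/

namespace RemoteEstimation

variable {n m : ℕ} {Ω : Type*} [MeasurableSpace Ω] {μ : Measure Ω} {M : RemoteEstimation n m Ω}

theorem IsModel.measurable_localEst (hM : M.IsModel μ) (k : ℕ) : Measurable (M.localEst μ k) :=
  ((M.stronglyMeasurable_localEst μ k).mono (hM.sensorInfo_le k)).measurable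

theorem IsModel.remoteInfo_le (hM : M.IsModel μ) (k : ℕ) :
    M.remoteInfo μ k ≤ ‹MeasurableSpace Ω› :=
  iSup₂_le fun j _ => sup_le (hM.measurable_γ j).comap_le
    ((hM.measurable_γ j).smul (hM.measurable_localEst j)).comap_le

theorem remoteInfo_mono (M : RemoteEstimation n m Ω) (μ : Measure Ω) :
    Monotone (M.remoteInfo μ) :=
  fun _ _ h => biSup_mono fun _ hj =>
    Finset.mem_Icc.2 ⟨(Finset.mem_Icc.1 hj).1, (Finset.mem_Icc.1 hj).2.trans h⟩

theorem IsModel.measurable_γ_remoteInfo (hM : M.IsModel μ) {j k : ℕ} (h : j ≤ k) :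
    Measurable[M.remoteInfo μ k] (M.γ j) := by
  rcases Nat.eq_zero_or_pos j with rfl | hj
  · rw [show M.γ 0 = fun _ => 1 from funext hM.γ_zero]
    exact measurable_const
  · exact measurable_iff_comap_le.2
      (le_iSup₂_of_le j (Finset.mem_Icc.2 ⟨hj, h⟩) le_sup_left)

theorem IsModel.measurable_γ_smul_localEst (hM : M.IsModel μ) {j k : ℕ} (h : j ≤ k) :
    Measurable[M.remoteInfo μ k] fun s => M.γ j s • M.localEst μ j s := by
  rcases Nat.eq_zero_or_pos j with rfl | hj
  -- The σ-algebra `sensorInfo 0` is a supremum over an empty range, so it lies below every other.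
  · have h0 : Measurable[M.remoteInfo μ k] (M.localEst μ 0) :=
      (M.stronglyMeasurable_localEst μ 0).measurable.mono (iSup₂_le fun i hi => by simp at hi) le_rfl
    simpa [hM.γ_zero] using h0
  · exact measurable_iff_comap_le.2
      (le_iSup₂_of_le j (Finset.mem_Icc.2 ⟨hj, h⟩) le_sup_right)

theorem IsModel.measurable_lastArrival (hM : M.IsModel μ) (k : ℕ) :
    Measurable[M.remoteInfo μ k] fun s => lastArrival (M.arrivals s) (k + 1) := by
  classical
  induction k with
  | zero =>
    rw [show (fun s => lastArrival (M.arrivals s) 1) = fun _ => 0 from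
      funext fun s => lastArrival_succ_of_mem (hM.zero_mem_arrivals s)]
    exact measurable_const
  | succ k ih =>
    have h : (fun s => lastArrival (M.arrivals s) (k + 1 + 1)) = fun s =>
        if s ∈ M.γ (k + 1) ⁻¹' {1} then k + 1 else lastArrival (M.arrivals s) (k + 1) := by
      ext s
      split_ifs with hs
      exacts [lastArrival_succ_of_mem hs, lastArrival_succ_of_notMem hs]
    rw [h]
    exact Measurable.ite (hM.measurable_γ_remoteInfo le_rfl (measurableSet_singleton 1))
      measurable_const (ih.mono (M.remoteInfo_mono μ k.le_succ) le_rfl)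

/-- The factor `γ j` equals `1` where `j` is the last arrival. Inserting it makes each term a
function of what the remote estimator has received. -/
theorem IsModel.prediction_eq_sum (hM : M.IsModel μ) (k : ℕ) :
    M.prediction μ (k + 1) = fun s => ∑ j ∈ Finset.range (k + 1),
      ((fun s => lastArrival (M.arrivals s) (k + 1)) ⁻¹' {j}).indicator
        (fun s => (M.A ^ (k + 1 - j)).toEuclideanLin (M.γ j s • M.localEst μ j s)) s := by
  ext1 s
  have hL := lastArrival_mem (hM.zero_mem_arrivals s) (Nat.le_add_left 1 k)
  have hγ : M.γ (lastArrival (M.arrivals s) (k + 1)) s = 1 := hL.2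
  rw [Finset.sum_eq_single_of_mem _ (Finset.mem_range.2 hL.1), hM.prediction_eq (by omega)]
  · simp [hγ]
  · intro j _ hj
    simp [Ne.symm hj]

theorem IsModel.measurable_prediction (hM : M.IsModel μ) (k : ℕ) :
    Measurable[M.remoteInfo μ k] (M.prediction μ (k + 1)) := by
  rw [hM.prediction_eq_sum]
  refine @Finset.measurable_fun_sum _ _ _ _ _ _ (M.remoteInfo μ k) _ _ fun j hj => ?_
  refine Measurable.indicator ?_ (hM.measurable_lastArrival k (measurableSet_singleton j))
  exact (measurable_toEuclideanLin _).comp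
    (hM.measurable_γ_smul_localEst (Nat.lt_succ_iff.1 (Finset.mem_range.1 hj)))

theorem IsModel.integrable_γ_smul (hM : M.IsModel μ) (k : ℕ) {f : Ω → Vec n}
    (hf : Integrable f μ) : Integrable (fun s => M.γ k s • f s) μ :=
  hf.bdd_smul 1 (hM.measurable_γ k).aestronglyMeasurable (.of_forall fun s => by
    rcases hM.γ_mem k s with h | h <;> simp [h])

theorem IsModel.integrable_prediction (hM : M.IsModel μ) (k : ℕ) :
    Integrable (M.prediction μ (k + 1)) μ := by
  rw [hM.prediction_eq_sum]
  refine integrable_finsetSum _ fun j _ => Integrable.indicator ?_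
    (((hM.measurable_lastArrival k).mono (hM.remoteInfo_le k) le_rfl) (measurableSet_singleton j))
  exact integrable_toEuclideanLin _ (hM.integrable_γ_smul j (hM.integrable_localEst j))

theorem IsModel.integrable_innovation (hM : M.IsModel μ) (k : ℕ) :
    Integrable (M.innovation μ (k + 1)) μ :=
  (hM.integrable_localEst _).sub (hM.integrable_prediction k)

variable [IsProbabilityMeasure μ]

/-- The information of the remote estimator, and whether the packet of time `k` is lost, do not
reveal the sign of the incremental innovation of a lost packet. -/
theorem IsModel.setIntegral_innovation_inter_drop (hM : M.IsModel μ) (k : ℕ) (c : Fin n)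
    {S : Set Ω} (hS : MeasurableSet[M.remoteInfo μ (k + 1)] S) :
    ∫ s in S ∩ M.γ (k + 1) ⁻¹' {0}, M.innovation μ (k + 1) s c ∂μ = 0 := by
  have hD : MeasurableSet (M.γ (k + 1) ⁻¹' {0}) := hM.measurable_γ _ (measurableSet_singleton 0)
  refine hM.setIntegral_eq_zero_of_patternEvent (k + 1) ((hM.integrable_innovation k).coord c)
    ((hM.remoteInfo_le _ _ hS).inter hD) fun G h0 => ?_
  have hP := hM.measurableSet_patternEvent G (k + 1)
  by_cases hk : k + 1 ∈ G
  · have h : S ∩ M.γ (k + 1) ⁻¹' {0} ∩ M.patternEvent G (k + 1) = ∅ := by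
      refine Set.eq_empty_of_forall_notMem fun s hs => ?_
      have h1 : M.γ (k + 1) s = 0 := hs.1.2
      have h2 := (hs.2 (k + 1) le_rfl).2 hk
      simp [h1] at h2
    simp [h]
  · have hL := (lastArrival_mem h0 (Nat.le_add_left 1 k)).1
    -- As `k + 1 ∉ G`, no arrival of the pattern up to `k + 1` is later than the last one before `k
    -- + 1`.
    obtain ⟨B, hB, hBS⟩ := hM.exists_measurableSet_sensorInfo_inter_eq
      (j := lastArrival G (k + 1)) (fun i hi hiG => le_lastArrival (lt_of_le_of_ne
        (Finset.mem_Icc.1 hi).2 fun h => hk (h ▸ hiG)) hiG) hS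
    have hsub : M.patternEvent G (k + 1) ⊆ M.γ (k + 1) ⁻¹' {0} := fun s hs =>
      (hM.γ_ne_one_iff _ s).1 fun h => hk ((hs (k + 1) le_rfl).1 h)
    have hB' := M.sensorInfo_le_noiseInfo _ _ hB
    rw [Set.inter_assoc, Set.inter_eq_self_of_subset_right hsub, hBS]
    have hstep : ∫ s in B ∩ M.patternEvent G (k + 1), M.innovation μ (k + 1) s c ∂μ =
        ∫ s in M.patternEvent G (k + 1), B.indicator (fun _ => 1) s *
          M.increment μ (lastArrival G (k + 1)) (k + 1) s c ∂μ := by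
      rw [Set.inter_comm, ← setIntegral_indicator (hM.noiseInfo_le _ hB')]
      refine setIntegral_congr_fun hP fun s hs => ?_
      by_cases hsB : s ∈ B
      · simp [hsB, hM.innovation_eq (Nat.le_add_left 1 k),
          lastArrival_eq_of_mem_patternEvent hs (Nat.le_succ _)]
      · simp [hsB]
    rw [hstep, hM.setIntegral_patternEvent h0 (k + 1)]
    · exact hM.integral_increment_mul_prod_transProb h0 (by omega) c
        (measurable_const.indicator hB)
    · exact (measurable_const.indicator hB').mul (M.measurable_increment_noiseInfo μ hL.le c)
    · refine (((hM.integrable_increment (lastArrival G (k + 1)) (k + 1)).coord c).indicator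
        (hM.noiseInfo_le _ hB')).congr (.of_eq (funext fun s => ?_))
      by_cases hsB : s ∈ B <;> simp [hsB]

/-- Given the information of the remote estimator, the state and its local estimate have the same
mean. -/
theorem IsModel.setIntegral_x_sub_localEst (hM : M.IsModel μ) (k : ℕ) (c : Fin n) {S : Set Ω}
    (hS : MeasurableSet[M.remoteInfo μ k] S) :
    ∫ s in S, (M.x k s c - M.localEst μ k s c) ∂μ = 0 := by
  have hint : Integrable (fun s => M.x k s c - M.localEst μ k s c) μ :=
    ((hM.integrable_x k).coord c).sub ((hM.integrable_localEst k).coord c)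
  refine hM.setIntegral_eq_zero_of_patternEvent k hint (hM.remoteInfo_le _ _ hS) fun G h0 => ?_
  obtain ⟨B, hB, hBS⟩ := hM.exists_measurableSet_sensorInfo_inter_eq
    (fun i hi _ => (Finset.mem_Icc.1 hi).2) hS
  have hB' := M.sensorInfo_le_noiseInfo _ _ hB
  have hc : Measurable fun z : Vec n => z c := by fun_prop
  have hm : Measurable[M.noiseInfo] fun s => M.x k s c - M.localEst μ k s c :=
    (hc.comp (M.measurable_x_noiseInfo k)).sub (hc.comp
      ((M.stronglyMeasurable_localEst μ k).measurable.mono (M.sensorInfo_le_noiseInfo k) le_rfl))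
  rw [hBS, Set.inter_comm, ← setIntegral_indicator (hM.noiseInfo_le _ hB'),
    hM.setIntegral_patternEvent h0 k (hm.indicator hB') (hint.indicator (hM.noiseInfo_le _ hB'))]
  -- This weight is bounded and known to the sensor at time `k`, so the state may be replaced by its
  -- local estimate against it.
  let g : Ω → ℝ := B.indicator fun s => ∏ i ∈ Finset.Icc 1 k, M.transProb μ G i s
  have hg : Measurable[M.sensorInfo k] g := (M.measurable_prod_transProb μ h0 k).indicator hB
  have hg' (s) : g s ∈ Set.Icc (0 : ℝ) 1 := by
    by_cases hsB : s ∈ B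
    · simpa [g, hsB] using hM.prod_transProb_mem G (Finset.Icc 1 k) s
    · simp [g, hsB]
  have hgm := hg.mono (hM.sensorInfo_le k) le_rfl
  have hxg := integrable_mul_of_mem_Icc ((hM.integrable_x k).coord c) hgm hg'
  have heg := integrable_mul_of_mem_Icc ((hM.integrable_localEst k).coord c) hgm hg'
  have h := integral_condExp_mul (hM.sensorInfo_le k) hg.stronglyMeasurable hxg
    ((hM.integrable_x k).coord c)
  have h' : ∫ s, M.localEst μ k s c * g s ∂μ = ∫ s, M.x k s c * g s ∂μ := by
    rw [← h]
    refine integral_congr_ae ?_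
    filter_upwards [condExp_coord (H := M.sensorInfo k) (hM.integrable_x k) c] with s hs
    rw [hs, localEst]
  calc _ = ∫ s, (M.x k s c * g s - M.localEst μ k s c * g s) ∂μ := by
        congr with s
        by_cases hsB : s ∈ B
        · simp [g, hsB, sub_mul]
        · simp [g, hsB]
    _ = 0 := by rw [integral_sub hxg heg, h', sub_self]

/-- The candidate is a function of the remote information and equals the local estimate minus the
innovation on the loss event. The two vanishing integrals above give it the set integrals of the
state. -/
theorem IsModel.remoteEst_ae_eq (hM : M.IsModel μ) (k : ℕ) :
    M.remoteEst μ (k + 1) =ᵐ[μ] fun s => M.γ (k + 1) s • M.localEst μ (k + 1) s +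
      (1 - M.γ (k + 1) s) • M.prediction μ (k + 1) s := by
  have hpi := hM.integrable_prediction k
  have hint : Integrable (fun s => M.γ (k + 1) s • M.localEst μ (k + 1) s +
      (1 - M.γ (k + 1) s) • M.prediction μ (k + 1) s) μ := by
    simp_rw [sub_smul, one_smul]
    exact (hM.integrable_γ_smul _ (hM.integrable_localEst _)).add
      (hpi.sub (hM.integrable_γ_smul _ hpi))
  refine (ae_eq_condExp_of_forall_setIntegral_eq (hM.remoteInfo_le _) (hM.integrable_x (k + 1))
    (fun _ _ _ => hint.integrableOn) (fun S hS _ => ?_) ?_).symm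
  · ext c
    rw [← integral_coord hint.integrableOn, ← integral_coord (hM.integrable_x _).integrableOn]
    have h1 := hM.setIntegral_innovation_inter_drop k c hS
    have h2 := hM.setIntegral_x_sub_localEst (k + 1) c hS
    have hD : MeasurableSet (M.γ (k + 1) ⁻¹' {0}) := hM.measurable_γ _ (measurableSet_singleton 0)
    have hii := (hM.integrable_innovation k).coord c
    have hxi := (hM.integrable_x (k + 1)).coord c
    have hei := (hM.integrable_localEst (k + 1)).coord c
    rw [← setIntegral_indicator hD] at h1
    rw [integral_sub hxi.integrableOn hei.integrableOn, sub_eq_zero] at h2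
    rw [h2, ← sub_zero (∫ s in S, M.localEst μ (k + 1) s c ∂μ), ← h1,
      ← integral_sub hei.integrableOn (hii.indicator hD).integrableOn]
    congr with s
    rcases hM.γ_mem (k + 1) s with h | h
    · have : s ∈ M.γ (k + 1) ⁻¹' {0} := h
      simp [h, this, innovation]
    · have : s ∉ M.γ (k + 1) ⁻¹' {0} := by simp [h]
      simp [h, this]
  · refine StronglyMeasurable.aestronglyMeasurable (Measurable.stronglyMeasurable ?_)
    exact (hM.measurable_γ_smul_localEst le_rfl).add
      (((hM.measurable_γ_remoteInfo le_rfl).const_sub 1).smul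
        ((hM.measurable_prediction k).mono (M.remoteInfo_mono μ k.le_succ) le_rfl))

theorem IsModel.condExp_innovation_cond_drop (hM : M.IsModel μ) (k : ℕ) :
    (ProbabilityTheory.cond μ (M.γ (k + 1) ⁻¹' {0}))[M.innovation μ (k + 1) | M.remoteInfo μ k]
      =ᵐ[ProbabilityTheory.cond μ (M.γ (k + 1) ⁻¹' {0})] 0 := by
  set D := M.γ (k + 1) ⁻¹' {0} with hD
  -- If a loss has probability zero, the conditioned measure is the zero measure and the claim is
  -- vacuous.
  by_cases h0 : μ D = 0
  · rw [cond_eq_zero_of_meas_eq_zero h0]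
    simp [Filter.EventuallyEq]
  have := cond_isProbabilityMeasure h0
  have hint : Integrable (M.innovation μ (k + 1)) (ProbabilityTheory.cond μ D) :=
    (hM.integrable_innovation k).restrict.smul_measure (ENNReal.inv_ne_top.2 h0)
  refine (ae_eq_condExp_of_forall_setIntegral_eq (hM.remoteInfo_le k) hint
    (fun _ _ _ => integrableOn_zero) (fun S hS _ => ?_)
    stronglyMeasurable_zero.aestronglyMeasurable).symm
  -- Up to normalization this is an integral over `S ∩ D`, and `S` also belongs to the larger
  -- information at time `k + 1`.
  have h : ∫ s in S, M.innovation μ (k + 1) s ∂(ProbabilityTheory.cond μ D) = 0 := by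
    ext c
    rw [← integral_coord hint.integrableOn, ProbabilityTheory.cond, Measure.restrict_smul,
      integral_smul_measure, Measure.restrict_restrict (hM.remoteInfo_le k _ hS),
      hM.setIntegral_innovation_inter_drop k c (M.remoteInfo_mono μ k.le_succ _ hS)]
    simp
  rw [h]
  simp

end RemoteEstimation

theorem mainTheorem3 {n m : ℕ} {Ω : Type*} [MeasurableSpace Ω] (μ : Measure Ω)
    [IsProbabilityMeasure μ] (M : RemoteEstimation n m Ω) (hM : M.IsModel μ)
    (k : ℕ) (hk : 1 ≤ k) :
    Integrable (M.x k) μ ∧ Integrable (M.innovation μ k) μ ∧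
    (∀ᵐ s ∂μ,
      (M.γ k s = 1 → M.remoteEst μ k s = M.localEst μ k s) ∧
      (M.γ k s = 0 → M.remoteEst μ k s =
        (M.A ^ M.holdingTime k s).toEuclideanLin
          (M.localEst μ (k - M.holdingTime k s) s))) ∧
    (∀ s, M.γ k s = 1 → M.localEst μ k s =
      (M.A ^ M.holdingTime k s).toEuclideanLin
        (M.localEst μ (k - M.holdingTime k s) s) + M.innovation μ k s) ∧
    (ProbabilityTheory.cond μ (M.γ k ⁻¹' {0}))[M.innovation μ k | M.remoteInfo μ (k - 1)]
      =ᵐ[ProbabilityTheory.cond μ (M.γ k ⁻¹' {0})] 0 := by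
  obtain ⟨k, rfl⟩ := Nat.exists_eq_add_of_le' hk
  refine ⟨hM.integrable_x _, hM.integrable_innovation k, ?_, fun s _ => ?_,
    hM.condExp_innovation_cond_drop k⟩
  · filter_upwards [hM.remoteEst_ae_eq k] with s hs
    refine ⟨fun h => by simp [hs, h], fun h => ?_⟩
    rw [hs, h, zero_smul, zero_add, sub_zero, one_smul]
    rfl
  · exact (add_sub_cancel _ _).symm
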